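/- For integers $k \ge 1$ and $n \ge 2k+1$, let $G_{n,k}$ be the $k$-nearest-neighbor circulant graph on $n$ nodes $0,\dots,n-1$, in which node $i$ is adjacent to $i\pm1,\dots,i\pm k$ modulo $n$. Let $A$ be its adjacency matrix, $L$ its graph Laplacian, and $\lambda_1(L)\le\cdots\le\lambda_n(L)$ the eigenvalues of $L$. For a coupling constant $K>0$ consider the Kuramoto system $$\frac{d\theta_i}{dt} = K\sum_{j} A_{ij}\sin(\theta_j-\theta_i).$$ A zero $\theta$ of the right-hand side is an equilibrium; it is *stable* if it is Lyapunov stable and every trajectory starting close enough to it converges to $\theta + c\mathbf 1$ for some $c\in\mathbf R$ (the system is invariant under common phase shifts); it is *unsynchronized* if the $\theta_i$ are not all equal modulo $2\pi$. The *twisted state* is $\theta_i = 2\pi i/n$. 1. There is $N$ such that for all $n\ge N$ and all $k \ge 1$ with $n \ge 2k+1$: if $\lambda_n(L)/\lambda_2(L) > 2$, then, for every $K>0$, the twisted state is an unsynchronized stable equilibrium of the Kuramoto system on $G_{n,k}$. 2. Let $$\kappa(\mu) = \frac{\mu - \frac{\sin(2\pi\mu)}{2\pi}}{\mu-\frac{\sin(\pi\mu)}{\pi}}.$$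 If $n,k\to\infty$ with $2k/n\to\mu\ge 0.6$, then $\lambda_n(L)/\lambda_2(L)\to\kappa(\mu)$. The function $\kappa$ is analytic and strictly decreasing on $[0.6,1]$, and $\kappa(\mu_c)=2$, where $\mu_c\approx 0.68$ (precisely, $|\mu_c-0.68|<0.005$) is the critical density: for every $K>0$, whenever $n,k\to\infty$ with $2k/n\to\mu$, the twisted state is eventually a stable equilibrium if $\mu<\mu_c$, and eventually not a stable equilibrium if $\mu>\mu_c$. 3. Consequently, for every $\epsilon>0$ there are $k\ge1$ and $n\ge 2k+1$ such that $\lambda_n(L)/\lambda_2(L)\le 2+\epsilon$ for $G_{n,k}$ and, for every $K>0$, the twisted state is an unsynchronized stable equilibrium of the Kuramoto system on $G_{n,k}$. -/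

import Mathlib

open Filter Topology

noncomputable section

namespace Kuramoto

/-- The `k`-nearest-neighbor circulant graph on the `n` nodes `0, …, n - 1`: node `i` is joined to
`i ± 1, …, i ± k` modulo `n`. -/
def circulant (n k : ℕ) : SimpleGraph (Fin n) where
  Adj i j := i ≠ j ∧ ∃ d : ℕ, 1 ≤ d ∧ d ≤ k ∧
    ((i : ℕ) + d ≡ (j : ℕ) [MOD n] ∨ (j : ℕ) + d ≡ (i : ℕ) [MOD n])
  symm := ⟨fun _ _ h => ⟨h.1.symm, h.2.imp fun _ hd => ⟨hd.1, hd.2.1, hd.2.2.symm⟩⟩⟩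
  loopless := ⟨fun _ h => h.1 rfl⟩

/-- The admissible sizes: `k ≥ 1` and `n ≥ 2k + 1`. -/
def Admissible (n k : ℕ) : Prop := 1 ≤ k ∧ 2 * k + 1 ≤ n

open Classical in
/-- The adjacency matrix of the circulant graph. -/
def adj (n k : ℕ) : Matrix (Fin n) (Fin n) ℝ := (circulant n k).adjMatrix ℝ

open Classical in
/-- The graph Laplacian of the circulant graph. -/
def lap (n k : ℕ) : Matrix (Fin n) (Fin n) ℝ := (circulant n k).lapMatrix ℝ

theorem lap_isHermitian (n k : ℕ) : (lap n k).IsHermitian := by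
  classical
  exact SimpleGraph.isHermitian_lapMatrix ..

/-- The `m`-th eigenvalue `λ_m` of a real symmetric `n × n` matrix in increasing order,
`λ_1 ≤ ⋯ ≤ λ_n`, counted with multiplicity (`eigenvalues₀` lists them in decreasing order,
starting from the index `0`). Only used for `1 ≤ m ≤ n`. -/
def eig {n : ℕ} {M : Matrix (Fin n) (Fin n) ℝ} (hM : M.IsHermitian) (m : ℕ) : ℝ :=
  if h : 1 ≤ m ∧ m ≤ n then
    hM.eigenvalues₀ ⟨n - m, by rw [Fintype.card_fin]; omega⟩
  else 0

/-- The condition number `λ_n(L) / λ_2(L)` of the graph Laplacian. For admissible `n, k` the graph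
is connected, so that the denominator is positive. -/
def condNumber (n k : ℕ) : ℝ := eig (lap_isHermitian n k) n / eig (lap_isHermitian n k) 2

/-- The right-hand side of the Kuramoto system `θ_i' = K ∑_j A_ij sin (θ_j - θ_i)`. -/
def field {n : ℕ} (K : ℝ) (A : Matrix (Fin n) (Fin n) ℝ) (θ : Fin n → ℝ) : Fin n → ℝ :=
  fun i => K * ∑ j, A i j * Real.sin (θ j - θ i)

/-- `φ` solves the Kuramoto system for all times `t ≥ 0`. -/
def IsTrajectory {n : ℕ} (K : ℝ) (A : Matrix (Fin n) (Fin n) ℝ) (φ : ℝ → Fin n → ℝ) : Prop :=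
  ∀ t : ℝ, 0 ≤ t → HasDerivWithinAt φ (field K A (φ t)) (Set.Ici 0) t

/-- `θ` is an equilibrium of the Kuramoto system. -/
def IsEquilibrium {n : ℕ} (K : ℝ) (A : Matrix (Fin n) (Fin n) ℝ) (θ : Fin n → ℝ) : Prop :=
  field K A θ = 0

/-- `θ` is a stable equilibrium of the Kuramoto system: it is an equilibrium, it is stable in the
sense of Lyapunov, and every trajectory that starts close enough to it converges to it up to a
common shift of all phases (the system is invariant under such shifts). -/
def IsStableEquilibrium {n : ℕ} (K : ℝ) (A : Matrix (Fin n) (Fin n) ℝ) (θ : Fin n → ℝ) : Prop :=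
  IsEquilibrium K A θ ∧
  (∀ ε : ℝ, 0 < ε → ∃ δ : ℝ, 0 < δ ∧ ∀ φ : ℝ → Fin n → ℝ, IsTrajectory K A φ →
    ‖φ 0 - θ‖ < δ → ∀ t : ℝ, 0 ≤ t → ‖φ t - θ‖ < ε) ∧
  (∃ δ : ℝ, 0 < δ ∧ ∀ φ : ℝ → Fin n → ℝ, IsTrajectory K A φ →
    ‖φ 0 - θ‖ < δ → ∃ c : ℝ, Tendsto φ atTop (𝓝 fun i => θ i + c))

/-- All phases agree modulo `2π`. -/
def IsSynchronized {n : ℕ} (θ : Fin n → ℝ) : Prop :=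
  ∀ i j, (θ i : Real.Angle) = (θ j : Real.Angle)

/-- The (first) twisted state `θ_i = 2π i / n`. -/
def twisted (n : ℕ) : Fin n → ℝ := fun i => 2 * Real.pi * (i : ℕ) / n

/-- The sequence of circulant graphs with parameters `(n j, k j)` has limiting density `μ`:
`n, k → ∞` and `2k / n → μ`. -/
def HasDensity (n k : ℕ → ℕ) (μ : ℝ) : Prop :=
  (∀ j, Admissible (n j) (k j)) ∧ Tendsto n atTop atTop ∧ Tendsto k atTop atTop ∧
    Tendsto (fun j => 2 * (k j : ℝ) / (n j : ℝ)) atTop (𝓝 μ)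

/-- `μc` is the critical density: in the limit `n, k → ∞` with `2k / n → μ`, the twisted state is
eventually a stable equilibrium if `μ < μc`, and eventually not a stable one if `μ > μc`. -/
def IsCriticalDensity (K μc : ℝ) : Prop :=
  ∀ (n k : ℕ → ℕ) (μ : ℝ), HasDensity n k μ →
    (μ < μc → ∀ᶠ j in atTop, IsStableEquilibrium K (adj (n j) (k j)) (twisted (n j))) ∧
    (μc < μ → ∀ᶠ j in atTop, ¬ IsStableEquilibrium K (adj (n j) (k j)) (twisted (n j)))

/-- The limiting condition number. -/
def kappa (μ : ℝ) : ℝ :=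
  (μ - Real.sin (2 * Real.pi * μ) / (2 * Real.pi)) / (μ - Real.sin (Real.pi * μ) / Real.pi)

end Kuramoto

end

/-!
The Kuramoto field is `K` times the negative gradient of the energy `-½ ∑ A i j cos (θ j - θ i)`,
so stability of an equilibrium is governed by the Hessian there, a weighted graph Laplacian. At
the twisted state this Hessian is circulant. It is diagonalized by the Fourier modes, with
eigenvalues `(λ (m + 1) + λ (m - 1)) / 2 - λ 1`, where
`λ m = 2k + 1 - sin ((2k + 1) m π / n) / sin (m π / n)` are the eigenvalues of the unweighted
Laplacian. The decisive mode is `m = 1`, with eigenvalue `λ 2 / 2 - λ 1`, and `λ 1` is the spectral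
gap of `L`. So the theorem comes down to comparing the largest `λ m` with `2 λ 1`: up to density
`0.6` the inequality `λ 2 > 2 λ 1` always holds, between `0.6` and `0.7` the largest eigenvalue is
`λ 2` itself, and beyond `0.7` the condition number is at most `2`. The limit `κ` is obtained from
`λ m / (2k + 1) → 1 - sinc (m π μ)`.
-/

namespace Kuramoto

open Real Finset

/-! ### Solutions for all positive times -/

section GlobalExistence

variable {E : Type*} [NormedAddCommGroup E] [NormedSpace ℝ E] {f : E → E} {L : NNReal}

theorem exists_forall_hasDerivWithinAt_Icc [CompleteSpace E] {C : NNReal} (hL : LipschitzWith L f)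
    (hC : ∀ x, ‖f x‖ ≤ C) (x₀ : E) {T : ℝ} (hT : 0 ≤ T) :
    ∃ α : ℝ → E, α 0 = x₀ ∧
      ∀ t ∈ Set.Icc 0 T, HasDerivWithinAt α (f (α t)) (Set.Icc 0 T) t := by
  have hpl : IsPicardLindelof (fun _ => f) (⟨0, Set.left_mem_Icc.2 hT⟩ : Set.Icc 0 T) x₀
      (C * T.toNNReal) 0 C L :=
    IsPicardLindelof.of_time_independent (fun x _ => hC x) hL.lipschitzOnWith (by simp [hT])
  exact hpl.exists_eq_forall_mem_Icc_hasDerivWithinAt₀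

theorem eqOn_Icc_of_hasDerivWithinAt (hL : LipschitzWith L f) {α β : ℝ → E} {S T : ℝ} (hST : S ≤ T)
    (hα : ∀ t ∈ Set.Icc 0 S, HasDerivWithinAt α (f (α t)) (Set.Icc 0 S) t)
    (hβ : ∀ t ∈ Set.Icc 0 T, HasDerivWithinAt β (f (β t)) (Set.Icc 0 T) t) (h0 : α 0 = β 0) :
    Set.EqOn α β (Set.Icc 0 S) := by
  have hasDerivWithinAt_Ici : ∀ {γ : ℝ → E} {R : ℝ}, S ≤ R →
      (∀ t ∈ Set.Icc 0 R, HasDerivWithinAt γ (f (γ t)) (Set.Icc 0 R) t) →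
      ∀ t ∈ Set.Ico 0 S, HasDerivWithinAt γ (f (γ t)) (Set.Ici t) t := fun hSR hγ t ht =>
    (hγ t ⟨ht.1, ht.2.le.trans hSR⟩).mono_of_mem_nhdsWithin <|
      mem_of_superset (Icc_mem_nhdsGE (ht.2.trans_le hSR)) (Set.Icc_subset_Icc_left ht.1)
  exact ODE_solution_unique_of_mem_Icc_right (v := fun _ => f) (s := fun _ => Set.univ)
    (fun _ _ => hL.lipschitzOnWith) (fun t ht => (hα t ht).continuousWithinAt)
    (hasDerivWithinAt_Ici le_rfl hα) (fun _ _ => Set.mem_univ _)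
    (fun t ht => (hβ t ⟨ht.1, ht.2.trans hST⟩).continuousWithinAt.mono
      (Set.Icc_subset_Icc_right hST))
    (hasDerivWithinAt_Ici hST hβ) (fun _ _ => Set.mem_univ _) h0

theorem exists_forall_hasDerivWithinAt_Ici [CompleteSpace E] {C : NNReal} (hL : LipschitzWith L f)
    (hC : ∀ x, ‖f x‖ ≤ C) (x₀ : E) :
    ∃ φ : ℝ → E, φ 0 = x₀ ∧ ∀ t, 0 ≤ t → HasDerivWithinAt φ (f (φ t)) (Set.Ici 0) t := by
  have hlocal (N : ℕ) := exists_forall_hasDerivWithinAt_Icc hL hC x₀ (T := N + 1) (by positivity)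
  choose α hα0 hα using hlocal
  have hagree {M N : ℕ} (hMN : M ≤ N) : Set.EqOn (α M) (α N) (Set.Icc 0 (M + 1)) :=
    eqOn_Icc_of_hasDerivWithinAt hL (by gcongr) (hα M) (hα N) (by rw [hα0, hα0])
  have hglue (N : ℕ) : ∀ s ∈ Set.Icc (0 : ℝ) (N + 1), α ⌊s⌋₊ s = α N s := by
    intro s hs
    rcases le_total ⌊s⌋₊ N with hle | hle
    · exact hagree hle ⟨hs.1, (Nat.lt_floor_add_one s).le⟩
    · exact (hagree hle hs).symm
  refine ⟨fun t => α ⌊t⌋₊ t, by simp [hα0], fun t ht => ?_⟩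
  have hlt := Nat.lt_floor_add_one t
  refine ((hα ⌊t⌋₊ t ⟨ht, hlt.le⟩).congr (hglue _) rfl).mono_of_mem_nhdsWithin ?_
  filter_upwards [mem_nhdsWithin_of_mem_nhds (Iio_mem_nhds hlt), self_mem_nhdsWithin]
    with s hs hs0 using ⟨hs0, le_of_lt hs⟩

end GlobalExistence

/-! ### The Kuramoto system on a weighted graph -/

section Weighted

variable {n : ℕ} {K : ℝ} {A : Matrix (Fin n) (Fin n) ℝ} {θ : Fin n → ℝ}

theorem abs_mul_sum_mul_le (K : ℝ) (A : Matrix (Fin n) (Fin n) ℝ) (i : Fin n) {g : Fin n → ℝ}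
    {B : ℝ} (hB : 0 ≤ B) (hg : ∀ j, |g j| ≤ B) :
    |K * ∑ j, A i j * g j| ≤ |K| * (∑ i, ∑ j, |A i j|) * B := by
  have hrow : ∑ j, |A i j| ≤ ∑ i, ∑ j, |A i j| :=
    single_le_sum (f := fun i => ∑ j, |A i j|)
      (fun i _ => sum_nonneg fun j _ => abs_nonneg _) (mem_univ i)
  calc |K * ∑ j, A i j * g j| ≤ |K| * ∑ j, |A i j * g j| := by
        rw [abs_mul]; gcongr; exact abs_sum_le_sum_abs _ _
    _ ≤ |K| * ∑ j, |A i j| * B := by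
        gcongr with j; rw [abs_mul]; gcongr; exact hg j
    _ = |K| * (∑ j, |A i j|) * B := by rw [← sum_mul, mul_assoc]
    _ ≤ |K| * (∑ i, ∑ j, |A i j|) * B := by gcongr

theorem norm_field_le (K : ℝ) (A : Matrix (Fin n) (Fin n) ℝ) (θ : Fin n → ℝ) :
    ‖field K A θ‖ ≤ |K| * ∑ i, ∑ j, |A i j| := by
  refine (pi_norm_le_iff_of_nonneg (by positivity)).2 fun i => ?_
  simpa [field] using
    abs_mul_sum_mul_le K A i zero_le_one fun j => abs_sin_le_one (θ j - θ i)

theorem lipschitzWith_field (K : ℝ) (A : Matrix (Fin n) (Fin n) ℝ) :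
    LipschitzWith (|K| * (∑ i, ∑ j, |A i j|) * 2).toNNReal (field K A) := by
  refine LipschitzWith.of_dist_le_mul fun θ η => ?_
  rw [Real.coe_toNNReal _ (by positivity), dist_eq_norm, mul_assoc]
  refine (pi_norm_le_iff_of_nonneg (by positivity)).2 fun i => ?_
  have hsub : (field K A θ - field K A η) i =
      K * ∑ j, A i j * (sin (θ j - θ i) - sin (η j - η i)) := by
    simp only [field, Pi.sub_apply, mul_sub, sum_sub_distrib]
  rw [hsub, Real.norm_eq_abs]
  refine abs_mul_sum_mul_le K A i (by positivity) fun j => ?_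
  have hdist (l : Fin n) : |θ l - η l| ≤ dist θ η := dist_le_pi_dist θ η l
  calc |sin (θ j - θ i) - sin (η j - η i)| ≤ |(θ j - η j) - (θ i - η i)| := by
        rw [sub_sub_sub_comm]; exact abs_sin_sub_sin_le _ _
    _ ≤ 2 * dist θ η := (abs_sub _ _).trans (by linarith [hdist i, hdist j])

theorem exists_isTrajectory (K : ℝ) (A : Matrix (Fin n) (Fin n) ℝ) (θ₀ : Fin n → ℝ) :
    ∃ φ, IsTrajectory K A φ ∧ φ 0 = θ₀ := by
  obtain ⟨φ, hφ0, hφ⟩ := exists_forall_hasDerivWithinAt_Ici (lipschitzWith_field K A)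
    (C := (|K| * ∑ i, ∑ j, |A i j|).toNNReal)
    (fun θ => (norm_field_le K A θ).trans (Real.le_coe_toNNReal _)) θ₀
  exact ⟨φ, hφ, hφ0⟩

theorem field_add_const (K : ℝ) (A : Matrix (Fin n) (Fin n) ℝ) (θ : Fin n → ℝ) (c : ℝ) :
    field K A (fun i => θ i + c) = field K A θ := by
  funext i
  simp only [field, add_sub_add_right_eq_sub]

theorem IsTrajectory.hasDerivWithinAt_apply {φ : ℝ → Fin n → ℝ} (hφ : IsTrajectory K A φ) {t : ℝ}
    (ht : 0 ≤ t) (i : Fin n) :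
    HasDerivWithinAt (fun s => φ s i) (field K A (φ t) i) (Set.Ici 0) t :=
  hasDerivWithinAt_pi.1 (hφ t ht) i

/-- The derivative of `-field 1 A` at `θ`: the Laplacian of the graph with the weights
`A i j * cos (θ j - θ i)`. -/
noncomputable def linearization (A : Matrix (Fin n) (Fin n) ℝ) (θ u : Fin n → ℝ) : Fin n → ℝ :=
  fun i => ∑ j, A i j * cos (θ j - θ i) * (u i - u j)

/-- The potential of the Kuramoto system: `field K A` is `-K / 2` times its gradient when `A` is
symmetric. -/
noncomputable def energy (A : Matrix (Fin n) (Fin n) ℝ) (θ : Fin n → ℝ) : ℝ :=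
  -∑ i, ∑ j, A i j * cos (θ j - θ i)

theorem two_mul_sum_mul_antisymm (u : Fin n → ℝ) {g : Fin n → Fin n → ℝ}
    (hg : ∀ i j, g j i = -g i j) :
    2 * ∑ i, u i * ∑ j, g i j = ∑ i, ∑ j, (u i - u j) * g i j := by
  have hswap : ∑ i, ∑ j, u j * g i j = -∑ i, ∑ j, u i * g i j := by
    simp only [sum_comm (f := fun i j => u j * g i j), ← sum_neg_distrib, ← mul_neg, ← hg]
  simp only [sub_mul, sum_sub_distrib, hswap, ← mul_sum]
  ring

theorem two_mul_dotProduct_field (hA : A.IsSymm) (K : ℝ) (u θ : Fin n → ℝ) :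
    2 * (u ⬝ᵥ field K A θ) = -(K * ∑ i, ∑ j, A i j * ((u j - u i) * sin (θ j - θ i))) := by
  have hfactor : u ⬝ᵥ field K A θ = K * ∑ i, u i * ∑ j, A i j * sin (θ j - θ i) := by
    rw [dotProduct, mul_sum]
    exact sum_congr rfl fun i _ => mul_left_comm _ _ _
  have hanti : ∀ i j, A j i * sin (θ i - θ j) = -(A i j * sin (θ j - θ i)) := fun i j => by
    rw [hA.apply i j, ← neg_sub (θ j) (θ i), sin_neg, mul_neg]
  rw [hfactor, mul_left_comm, two_mul_sum_mul_antisymm u hanti, ← mul_neg]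
  simp only [← sum_neg_distrib]
  congr! 3
  ring

theorem two_mul_dotProduct_linearization (hA : A.IsSymm) (θ u v : Fin n → ℝ) :
    2 * (u ⬝ᵥ linearization A θ v) =
      ∑ i, ∑ j, A i j * cos (θ j - θ i) * ((u j - u i) * (v j - v i)) := by
  have hanti : ∀ i j, A j i * cos (θ i - θ j) * (v j - v i) =
      -(A i j * cos (θ j - θ i) * (v i - v j)) := fun i j => by
    rw [hA.apply i j, ← neg_sub (θ j) (θ i), cos_neg]; ring
  refine (two_mul_sum_mul_antisymm u hanti).trans ?_
  congr! 2
  ring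

theorem dotProduct_linearization_comm (hA : A.IsSymm) (θ u v : Fin n → ℝ) :
    u ⬝ᵥ linearization A θ v = v ⬝ᵥ linearization A θ u := by
  refine mul_left_cancel₀ two_ne_zero ?_
  simp only [two_mul_dotProduct_linearization hA]
  congr! 3
  ring

theorem sum_field_eq_zero (hA : A.IsSymm) (K : ℝ) (θ : Fin n → ℝ) : ∑ i, field K A θ i = 0 := by
  simpa [dotProduct] using two_mul_dotProduct_field hA K (fun _ => 1) θ

theorem IsTrajectory.sum_eq {φ : ℝ → Fin n → ℝ} (hφ : IsTrajectory K A φ) (hA : A.IsSymm) {t : ℝ}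
    (ht : 0 ≤ t) : ∑ i, φ t i = ∑ i, φ 0 i := by
  have hderiv : ∀ s, 0 ≤ s → HasDerivWithinAt (fun s => ∑ i, φ s i) 0 (Set.Ici 0) s := by
    intro s hs
    have hsum := HasDerivWithinAt.fun_sum fun i (_ : i ∈ univ) => hφ.hasDerivWithinAt_apply hs i
    rwa [sum_field_eq_zero hA] at hsum
  exact constant_of_has_deriv_right_zero
    (fun s hs => (hderiv s hs.1).continuousWithinAt.mono Set.Icc_subset_Ici_self)
    (fun s hs => (hderiv s hs.1).mono (Set.Ici_subset_Ici.2 hs.1)) t ⟨ht, le_rfl⟩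

end Weighted

/-! ### A spectral gap of the linearization implies stability -/

section Stability

variable {n : ℕ} {K γ : ℝ} {A : Matrix (Fin n) (Fin n) ℝ} {θ : Fin n → ℝ}

/-- The linearization at `θ` is bounded below by `γ` on the vectors with mean zero, that is,
transversally to the common phase shifts. -/
def HasSpectralGap (A : Matrix (Fin n) (Fin n) ℝ) (θ : Fin n → ℝ) (γ : ℝ) : Prop :=
  ∀ u : Fin n → ℝ, ∑ i, u i = 0 → γ * (u ⬝ᵥ u) ≤ u ⬝ᵥ linearization A θ u

/-- The mean-zero part of `u`. -/
noncomputable def centered (u : Fin n → ℝ) : Fin n → ℝ := fun i => u i - (∑ j, u j) / n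

theorem sum_centered (u : Fin n → ℝ) : ∑ i, centered u i = 0 := by
  rcases eq_or_ne n 0 with rfl | hn
  · simp
  · simp [centered, sum_sub_distrib, mul_div_cancel₀, hn]

theorem continuous_centered : Continuous (centered : (Fin n → ℝ) → Fin n → ℝ) := by
  unfold centered
  fun_prop

theorem field_add_centered_sub (K : ℝ) (A : Matrix (Fin n) (Fin n) ℝ) (θ φ : Fin n → ℝ) :
    field K A (θ + centered (φ - θ)) = field K A φ := by
  rw [← field_add_const K A _ ((∑ j, (φ - θ) j) / n)]
  congr 1
  funext i
  simp only [centered, Pi.add_apply, Pi.sub_apply]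
  ring

theorem sq_le_dotProduct_self (u : Fin n → ℝ) (i : Fin n) : u i ^ 2 ≤ u ⬝ᵥ u := by
  rw [sq]
  exact single_le_sum (f := fun i => u i * u i) (fun i _ => mul_self_nonneg _) (mem_univ i)

theorem abs_sin_sub_self_le {w : ℝ} (hw : |w| ≤ 1) : |sin w - w| ≤ w ^ 2 / 2 := by
  have hsin := sin_bound hw
  have hcube : |w| ^ 3 ≤ |w| ^ 2 := pow_le_pow_of_le_one (abs_nonneg _) hw (by norm_num)
  have hfifth : |w| ^ 5 ≤ |w| ^ 2 := pow_le_pow_of_le_one (abs_nonneg _) hw (by norm_num)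
  calc |sin w - w| = |(sin w - (w - w ^ 3 / 6)) + -(w ^ 3 / 6)| := by ring_nf
    _ ≤ |sin w - (w - w ^ 3 / 6)| + |w| ^ 3 / 6 := by
        refine (abs_add_le _ _).trans_eq ?_
        rw [abs_neg, abs_div, abs_pow, abs_of_pos (show (0 : ℝ) < 6 by norm_num)]
    _ ≤ w ^ 2 / 2 := by rw [← sq_abs w]; nlinarith [sq_nonneg |w|]

theorem abs_mul_sin_add_sub_le {Δ w : ℝ} (hw : |w| ≤ 1) :
    |w * sin (Δ + w) - (w * sin Δ + cos Δ * w ^ 2)| ≤ |w| * w ^ 2 := by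
  have hcos : |cos w - 1| ≤ w ^ 2 / 2 := by
    rw [abs_le]; constructor <;> linarith [one_sub_sq_div_two_le_cos (x := w), cos_le_one w]
  calc |w * sin (Δ + w) - (w * sin Δ + cos Δ * w ^ 2)|
      = |w| * |sin Δ * (cos w - 1) + cos Δ * (sin w - w)| := by
        rw [← abs_mul, sin_add]; ring_nf
    _ ≤ |w| * (1 * (w ^ 2 / 2) + 1 * (w ^ 2 / 2)) := by
        gcongr
        refine (abs_add_le _ _).trans ?_
        rw [abs_mul, abs_mul]
        gcongr
        exacts [abs_sin_le_one Δ, abs_cos_le_one Δ, abs_sin_sub_self_le hw]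
    _ = |w| * w ^ 2 := by ring

theorem dotProduct_field_le_of_hasSpectralGap (hA : A.IsSymm) (hK : 0 < K)
    (hθ : IsEquilibrium K A θ) (hgap : HasSpectralGap A θ γ) {η : ℝ} (hη0 : 0 ≤ η)
    (hη : η ≤ 1 / 2) (hηγ : 8 * (∑ i, ∑ j, |A i j|) * η ≤ γ) {u : Fin n → ℝ}
    (hu : ∑ i, u i = 0) (huη : u ⬝ᵥ u ≤ η ^ 2) :
    2 * (u ⬝ᵥ field K A (θ + u)) ≤ -(K * γ) * (u ⬝ᵥ u) := by
  have hθu : ∑ i, ∑ j, A i j * ((u j - u i) * sin (θ j - θ i)) = 0 := by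
    have hdot := two_mul_dotProduct_field hA K u θ
    rw [hθ, dotProduct_zero, mul_zero, eq_comm, neg_eq_zero] at hdot
    exact (mul_eq_zero.1 hdot).resolve_left hK.ne'
  have hentry (i j : Fin n) : A i j * ((u j - u i) * sin (θ j - θ i)) +
      A i j * cos (θ j - θ i) * ((u j - u i) * (u j - u i)) - |A i j| * (8 * η * (u ⬝ᵥ u)) ≤
      A i j * ((u j - u i) * sin ((θ + u) j - (θ + u) i)) := by
    have habs (l : Fin n) : |u l| ≤ η :=
      abs_le_of_sq_le_sq ((sq_le_dotProduct_self u l).trans huη) hη0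
    have hw : |u j - u i| ≤ 2 * η := (abs_sub _ _).trans (by linarith [habs i, habs j])
    have hw2 : (u j - u i) ^ 2 ≤ 4 * (u ⬝ᵥ u) := by
      nlinarith [sq_nonneg (u j + u i), sq_le_dotProduct_self u i, sq_le_dotProduct_self u j]
    have htaylor := abs_mul_sin_add_sub_le (Δ := θ j - θ i) (w := u j - u i) (by linarith)
    have herror : |A i j * ((u j - u i) * sin (θ j - θ i + (u j - u i)) -
        ((u j - u i) * sin (θ j - θ i) + cos (θ j - θ i) * (u j - u i) ^ 2))| ≤
        |A i j| * (2 * η * (4 * (u ⬝ᵥ u))) := by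
      rw [abs_mul]
      gcongr
      exact htaylor.trans (by gcongr)
    have hshift : (θ + u) j - (θ + u) i = θ j - θ i + (u j - u i) := add_sub_add_comm _ _ _ _
    rw [hshift]
    linarith [neg_le_of_abs_le herror]
  have hsum := sum_le_sum fun i (_ : i ∈ univ) => sum_le_sum fun j (_ : j ∈ univ) => hentry i j
  simp only [sum_add_distrib, sum_sub_distrib, ← sum_mul, hθu,
    ← two_mul_dotProduct_linearization hA] at hsum
  have huu : 0 ≤ u ⬝ᵥ u := sum_nonneg fun i _ => mul_self_nonneg _
  rw [two_mul_dotProduct_field hA, neg_mul, neg_le_neg_iff, mul_assoc]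
  refine mul_le_mul_of_nonneg_left ?_ hK.le
  nlinarith [hgap u hu]

theorem le_mul_exp_of_deriv_le {S S' : ℝ → ℝ} {a b ρ : ℝ} (hb : 0 ≤ b) (hab : b < a) (hρ : 0 < ρ)
    (hS : ∀ t, 0 ≤ t → HasDerivWithinAt S (S' t) (Set.Ici 0) t) (hS0 : S 0 ≤ ρ)
    (hdecay : ∀ t, 0 ≤ t → S t ≤ ρ → S' t ≤ -a * S t) {t : ℝ} (ht : 0 ≤ t) :
    S t ≤ ρ * exp (-b * t) := by
  refine image_le_of_deriv_right_lt_deriv_boundary (B := fun s => ρ * exp (-b * s))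
    (B' := fun s => ρ * (exp (-b * s) * -b))
    (fun s hs => (hS s hs.1).continuousWithinAt.mono Set.Icc_subset_Ici_self)
    (fun s hs => (hS s hs.1).mono (Set.Ici_subset_Ici.2 hs.1)) (by simpa using hS0)
    (fun s => ?_) (fun s hs hcontact => ?_) ⟨ht, le_rfl⟩
  · exact ((hasDerivAt_const_mul (-b)).exp).const_mul ρ
  · have hpos : 0 < S s := hcontact ▸ by positivity
    have hexp : exp (-b * s) ≤ 1 := exp_le_one_iff.2 (by nlinarith [hs.1])
    have hle : S s ≤ ρ := hcontact ▸ mul_le_of_le_one_right hρ.le hexp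
    calc S' s ≤ -a * S s := hdecay s hs.1 hle
      _ < -b * S s := by gcongr
      _ = ρ * (exp (-b * s) * -b) := by rw [hcontact]; ring

theorem IsTrajectory.hasDerivWithinAt_centered {φ : ℝ → Fin n → ℝ} (hφ : IsTrajectory K A φ)
    (hA : A.IsSymm) (θ : Fin n → ℝ) {t : ℝ} (ht : 0 ≤ t) :
    HasDerivWithinAt (fun s => centered (φ s - θ) ⬝ᵥ centered (φ s - θ))
      (2 * (centered (φ t - θ) ⬝ᵥ field K A (φ t))) (Set.Ici 0) t := by
  have hentry (i : Fin n) : HasDerivWithinAt (fun s => centered (φ s - θ) i) (field K A (φ t) i)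
      (Set.Ici 0) t := by
    have hdiff (j : Fin n) := (hφ.hasDerivWithinAt_apply ht j).sub_const (θ j)
    have hmean := (HasDerivWithinAt.fun_sum fun j (_ : j ∈ univ) => hdiff j).div_const (n : ℝ)
    simpa [centered, sum_field_eq_zero hA] using (hdiff i).fun_sub hmean
  refine (HasDerivWithinAt.fun_sum fun i (_ : i ∈ univ) =>
    (hentry i).mul (hentry i)).congr_deriv ?_
  rw [dotProduct, mul_sum]
  exact sum_congr rfl fun i _ => by ring

theorem IsTrajectory.abs_centered_le {φ : ℝ → Fin n → ℝ} (hφ : IsTrajectory K A φ)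
    (hA : A.IsSymm) (hK : 0 < K) (hθ : IsEquilibrium K A θ) (hγ : 0 < γ)
    (hgap : HasSpectralGap A θ γ) {ρ : ℝ} (hρ0 : 0 < ρ) (hρ : ρ ≤ 1 / 2)
    (hργ : 8 * (∑ i, ∑ j, |A i j|) * ρ ≤ γ)
    (h0 : centered (φ 0 - θ) ⬝ᵥ centered (φ 0 - θ) ≤ ρ ^ 2) {t : ℝ} (ht : 0 ≤ t) (i : Fin n) :
    |centered (φ t - θ) i| ≤ ρ * exp (-(K * γ / 4) * t) := by
  have hdecay : centered (φ t - θ) ⬝ᵥ centered (φ t - θ) ≤ ρ ^ 2 * exp (-(K * γ / 2) * t) := by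
    refine le_mul_exp_of_deriv_le (a := K * γ) (by positivity) (half_lt_self (by positivity))
      (by positivity) (fun s hs => hφ.hasDerivWithinAt_centered hA θ hs) h0 (fun s _ hs => ?_) ht
    rw [← field_add_centered_sub K A θ]
    exact dotProduct_field_le_of_hasSpectralGap hA hK hθ hgap hρ0.le hρ hργ (sum_centered _) hs
  refine abs_le_of_sq_le_sq ?_ (by positivity)
  calc centered (φ t - θ) i ^ 2 ≤ ρ ^ 2 * exp (-(K * γ / 2) * t) :=
        (sq_le_dotProduct_self _ i).trans hdecay
    _ = (ρ * exp (-(K * γ / 4) * t)) ^ 2 := by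
        rw [mul_pow, ← exp_nat_mul]; congr 2; push_cast; ring

theorem exists_pos_forall_norm_sub_lt_centered (θ : Fin n → ℝ) {ρ : ℝ} (hρ : 0 < ρ) :
    ∃ δ : ℝ, 0 < δ ∧ ∀ φ : Fin n → ℝ, ‖φ - θ‖ < δ →
      |(∑ j, (φ - θ) j) / n| < ρ ∧ centered (φ - θ) ⬝ᵥ centered (φ - θ) ≤ ρ ^ 2 := by
  have hcont : Continuous fun u : Fin n → ℝ => |(∑ j, u j) / n| := by fun_prop
  have hmean : ∀ᶠ u : Fin n → ℝ in 𝓝 0, |(∑ j, u j) / n| < ρ :=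
    hcont.continuousAt.eventually_lt_const (by simpa using hρ)
  have hcent : ∀ᶠ u : Fin n → ℝ in 𝓝 0, centered u ⬝ᵥ centered u < ρ ^ 2 :=
    (continuous_centered.dotProduct continuous_centered).continuousAt.eventually_lt_const
      (by simpa [centered, dotProduct] using pow_pos hρ 2)
  obtain ⟨δ, hδ, hball⟩ := Metric.eventually_nhds_iff.1 (hmean.and hcent)
  refine ⟨δ, hδ, fun φ hφ => ?_⟩
  obtain ⟨hlt, hsq⟩ := hball (by rwa [dist_zero_right] : dist (φ - θ) 0 < δ)
  exact ⟨hlt, hsq.le⟩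

theorem IsTrajectory.sub_mean_eq_centered {φ : ℝ → Fin n → ℝ} (hφ : IsTrajectory K A φ)
    (hA : A.IsSymm) (θ : Fin n → ℝ) {t : ℝ} (ht : 0 ≤ t) (i : Fin n) :
    φ t i - (θ i + (∑ j, (φ 0 - θ) j) / n) = centered (φ t - θ) i := by
  simp only [centered, Pi.sub_apply, sum_sub_distrib, hφ.sum_eq hA ht]
  ring

theorem exists_pos_forall_abs_centered_le (hA : A.IsSymm) (hK : 0 < K)
    (hθ : IsEquilibrium K A θ) (hγ : 0 < γ) (hgap : HasSpectralGap A θ γ) :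
    ∃ η : ℝ, 0 < η ∧ ∀ ρ, 0 < ρ → ρ ≤ η → ∀ φ, IsTrajectory K A φ →
      centered (φ 0 - θ) ⬝ᵥ centered (φ 0 - θ) ≤ ρ ^ 2 → ∀ t, 0 ≤ t → ∀ i,
        |centered (φ t - θ) i| ≤ ρ * exp (-(K * γ / 4) * t) := by
  set W := 8 * ∑ i, ∑ j, |A i j|
  have : 0 ≤ W := by positivity
  refine ⟨min (1 / 2) (γ / (W + 1)), by positivity, fun ρ hρ hle φ hφ h0 t ht i => ?_⟩
  have hWρ := (le_div_iff₀ (by positivity)).1 (hle.trans (min_le_right _ _))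
  exact hφ.abs_centered_le hA hK hθ hγ hgap hρ (hle.trans (min_le_left _ _)) (by linarith) h0 ht i

theorem isStableEquilibrium_of_hasSpectralGap (hA : A.IsSymm) (hK : 0 < K)
    (hθ : IsEquilibrium K A θ) (hγ : 0 < γ) (hgap : HasSpectralGap A θ γ) :
    IsStableEquilibrium K A θ := by
  obtain ⟨η, hη, hdecay⟩ := exists_pos_forall_abs_centered_le hA hK hθ hγ hgap
  refine ⟨hθ, fun ε hε => ?_, ?_⟩
  · have hρ : 0 < min η (ε / 2) := by positivity
    obtain ⟨δ, hδ, hball⟩ := exists_pos_forall_norm_sub_lt_centered θ hρ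
    refine ⟨δ, hδ, fun φ hφ h0 t ht => (pi_norm_lt_iff hε).2 fun i => ?_⟩
    obtain ⟨hmean, hcent⟩ := hball _ h0
    have hexp : exp (-(K * γ / 4) * t) ≤ 1 :=
      exp_le_one_iff.2 (by nlinarith [mul_nonneg (mul_pos hK hγ).le ht])
    have hbound : |centered (φ t - θ) i| ≤ min η (ε / 2) :=
      (hdecay _ hρ (min_le_left _ _) φ hφ hcent t ht i).trans (mul_le_of_le_one_right hρ.le hexp)
    calc |φ t i - θ i| = |centered (φ t - θ) i + (∑ j, (φ 0 - θ) j) / n| := by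
          rw [← hφ.sub_mean_eq_centered hA θ ht i]; ring_nf
      _ ≤ |centered (φ t - θ) i| + |(∑ j, (φ 0 - θ) j) / n| := abs_add_le _ _
      _ < ε / 2 + ε / 2 := add_lt_add_of_le_of_lt (hbound.trans (min_le_right _ _))
          (hmean.trans_le (min_le_right _ _))
      _ = ε := add_halves ε
  · obtain ⟨δ, hδ, hball⟩ := exists_pos_forall_norm_sub_lt_centered θ hη
    refine ⟨δ, hδ, fun φ hφ h0 => ⟨(∑ j, (φ 0 - θ) j) / n, tendsto_pi_nhds.2 fun i => ?_⟩⟩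
    have hexp : Tendsto (fun t => η * exp (-(K * γ / 4) * t)) atTop (𝓝 0) := by
      simpa using (tendsto_exp_atBot.comp (tendsto_id.const_mul_atTop_of_neg
        (by linarith [mul_pos hK hγ] : -(K * γ / 4) < 0))).const_mul η
    rw [tendsto_iff_norm_sub_tendsto_zero]
    refine squeeze_zero' (Eventually.of_forall fun t => norm_nonneg _) ?_ hexp
    filter_upwards [eventually_ge_atTop 0] with t ht
    rw [Real.norm_eq_abs, hφ.sub_mean_eq_centered hA θ ht i]
    exact hdecay η hη le_rfl φ hφ (hball _ h0).2 t ht i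

end Stability

/-! ### A negative direction of the linearization implies instability -/

section Instability

variable {n : ℕ} {K : ℝ} {A : Matrix (Fin n) (Fin n) ℝ} {θ : Fin n → ℝ}

theorem continuous_energy (A : Matrix (Fin n) (Fin n) ℝ) : Continuous (energy A) := by
  unfold energy
  fun_prop

theorem energy_add_const (A : Matrix (Fin n) (Fin n) ℝ) (θ : Fin n → ℝ) (c : ℝ) :
    energy A (fun i => θ i + c) = energy A θ := by
  simp only [energy, add_sub_add_right_eq_sub]

theorem IsTrajectory.hasDerivWithinAt_energy {φ : ℝ → Fin n → ℝ} (hφ : IsTrajectory K A φ)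
    (hA : A.IsSymm) (hK : K ≠ 0) {t : ℝ} (ht : 0 ≤ t) :
    HasDerivWithinAt (fun s => energy A (φ s))
      (-(2 / K * (field K A (φ t) ⬝ᵥ field K A (φ t)))) (Set.Ici 0) t := by
  have hsum : HasDerivWithinAt (fun s => ∑ i, ∑ j, A i j * cos (φ s j - φ s i))
      (∑ i, ∑ j, A i j * (-sin (φ t j - φ t i) * (field K A (φ t) j - field K A (φ t) i)))
      (Set.Ici 0) t :=
    HasDerivWithinAt.fun_sum fun i _ => HasDerivWithinAt.fun_sum fun j _ =>
      ((hφ.hasDerivWithinAt_apply ht j).sub (hφ.hasDerivWithinAt_apply ht i)).cos.const_mul _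
  refine hsum.neg.congr_deriv ?_
  rw [div_mul_eq_mul_div, two_mul_dotProduct_field hA, neg_div, mul_div_cancel_left₀ _ hK, neg_inj]
  simp only [← sum_neg_distrib]
  congr! 2
  ring

theorem IsTrajectory.energy_le {φ : ℝ → Fin n → ℝ} (hφ : IsTrajectory K A φ) (hA : A.IsSymm)
    (hK : 0 < K) {t : ℝ} (ht : 0 ≤ t) : energy A (φ t) ≤ energy A (φ 0) := by
  have hderiv (s : ℝ) (hs : s ∈ Set.Ici 0) := hφ.hasDerivWithinAt_energy hA hK.ne' hs
  refine antitoneOn_of_hasDerivWithinAt_nonpos (convex_Ici 0)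
    (fun s hs => (hderiv s hs).continuousWithinAt)
    (fun s hs => (hderiv s (interior_subset hs)).mono interior_subset) (fun s _ => ?_)
    Set.self_mem_Ici ht ht
  have hsq : 0 ≤ field K A (φ s) ⬝ᵥ field K A (φ s) := sum_nonneg fun i _ => mul_self_nonneg _
  exact neg_nonpos.2 (by positivity)

theorem IsStableEquilibrium.isLocalMin_energy (hθ : IsStableEquilibrium K A θ) (hA : A.IsSymm)
    (hK : 0 < K) : IsLocalMin (energy A) θ := by
  obtain ⟨-, -, δ, hδ, hconv⟩ := hθ
  filter_upwards [Metric.ball_mem_nhds θ hδ] with η hη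
  obtain ⟨φ, hφ, hφ0⟩ := exists_isTrajectory K A η
  obtain ⟨c, hc⟩ := hconv φ hφ (by rwa [hφ0, ← dist_eq_norm])
  have hlim : Tendsto (energy A ∘ φ) atTop (𝓝 (energy A θ)) := by
    simpa only [energy_add_const] using ((continuous_energy A).tendsto _).comp hc
  refine le_of_tendsto hlim ?_
  filter_upwards [eventually_ge_atTop 0] with t ht
  exact hφ0 ▸ hφ.energy_le hA hK ht

theorem deriv_deriv_nonneg_of_isLocalMin {f : ℝ → ℝ} {a : ℝ} (hmin : IsLocalMin f a)
    (hf : ContinuousAt f a) : 0 ≤ deriv (deriv f) a := by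
  by_contra! hneg
  have hmax := isLocalMax_of_deriv_deriv_neg hneg hmin.deriv_eq_zero hf
  have hconst : f =ᶠ[𝓝 a] fun _ => f a := by
    filter_upwards [hmin, hmax] with x hle hge using le_antisymm hge hle
  have hzero : deriv (deriv f) a = 0 := by
    rw [hconst.deriv.deriv_eq]
    simp
  exact hneg.ne hzero

theorem hasDerivAt_energy_line (A : Matrix (Fin n) (Fin n) ℝ) (θ v : Fin n → ℝ) (s : ℝ) :
    HasDerivAt (fun s : ℝ => energy A (θ + s • v))
      (∑ i, ∑ j, A i j * (sin (θ j - θ i + s * (v j - v i)) * (v j - v i))) s := by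
  have hangle (i j : Fin n) :
      HasDerivAt (fun s : ℝ => (θ + s • v) j - (θ + s • v) i) (v j - v i) s := by
    have hcoord (l : Fin n) : HasDerivAt (fun s : ℝ => (θ + s • v) l) (v l) s := by
      simpa using ((hasDerivAt_id s).mul_const (v l)).const_add (θ l)
    exact (hcoord j).sub (hcoord i)
  have hsum := HasDerivAt.fun_sum fun i (_ : i ∈ univ) => HasDerivAt.fun_sum fun j (_ : j ∈ univ) =>
    (hangle i j).cos.const_mul (A i j)
  refine hsum.neg.congr_deriv ?_
  simp only [← sum_neg_distrib, Pi.add_apply, Pi.smul_apply, smul_eq_mul]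
  congr! 2
  ring_nf

theorem deriv_deriv_energy_line (hA : A.IsSymm) (θ v : Fin n → ℝ) :
    deriv (deriv fun s : ℝ => energy A (θ + s • v)) 0 = 2 * (v ⬝ᵥ linearization A θ v) := by
  rw [funext fun s => (hasDerivAt_energy_line A θ v s).deriv, two_mul_dotProduct_linearization hA]
  have hangle (i j : Fin n) :
      HasDerivAt (fun s : ℝ => θ j - θ i + s * (v j - v i)) (v j - v i) 0 := by
    simpa using ((hasDerivAt_id (0 : ℝ)).mul_const (v j - v i)).const_add (θ j - θ i)
  refine (HasDerivAt.fun_sum fun i (_ : i ∈ univ) => HasDerivAt.fun_sum fun j (_ : j ∈ univ) =>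
    ((hangle i j).sin.mul_const (v j - v i)).const_mul (A i j)).deriv.trans ?_
  simp only [zero_mul, add_zero]
  congr! 2
  ring

theorem IsStableEquilibrium.dotProduct_linearization_nonneg (hθ : IsStableEquilibrium K A θ)
    (hA : A.IsSymm) (hK : 0 < K) (v : Fin n → ℝ) : 0 ≤ v ⬝ᵥ linearization A θ v := by
  have hline : Tendsto (fun s : ℝ => θ + s • v) (𝓝 0) (𝓝 θ) := by
    simpa using (by fun_prop : Continuous fun s : ℝ => θ + s • v).tendsto 0
  have hmin : IsLocalMin (fun s : ℝ => energy A (θ + s • v)) 0 := by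
    simpa [IsLocalMin, IsMinFilter] using hline.eventually (hθ.isLocalMin_energy hA hK)
  have hnonneg := deriv_deriv_nonneg_of_isLocalMin hmin
    (hasDerivAt_energy_line A θ v 0).continuousAt
  rw [deriv_deriv_energy_line hA] at hnonneg
  linarith

end Instability

/-! ### Circulant sums -/

theorem adj_isSymm (n k : ℕ) : (adj n k).IsSymm := by
  classical
  exact SimpleGraph.isSymm_adjMatrix _

theorem circulant_adj_iff {n k : ℕ} (hkn : k < n) {i j : Fin n} :
    (circulant n k).Adj i j ↔
      ∃ e ∈ (Icc (-k : ℤ) k).erase 0, (n : ℤ) ∣ (i : ℕ) + e - (j : ℕ) := by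
  simp only [circulant, Nat.modEq_iff_dvd, mem_erase, mem_Icc]
  push_cast
  constructor
  · rintro ⟨-, d, hd, hdk, hij | hji⟩
    · exact ⟨d, by omega, by rwa [dvd_sub_comm]⟩
    · exact ⟨-d, by omega, by rwa [← sub_eq_add_neg, sub_sub, add_comm (d : ℤ)]⟩
  · rintro ⟨e, ⟨he, hek⟩, hdvd⟩
    refine ⟨?_, e.natAbs, by omega, by omega, ?_⟩
    · rintro rfl
      rw [add_sub_cancel_left] at hdvd
      exact he (Int.eq_zero_of_abs_lt_dvd hdvd (by rw [abs_lt]; omega))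
    · rcases le_total 0 e with hpos | hneg
      · left
        rwa [Int.natAbs_of_nonneg hpos, dvd_sub_comm]
      · right
        rwa [Int.ofNat_natAbs_of_nonpos hneg, ← sub_eq_add_neg, ← sub_add, sub_add_eq_add_sub]

theorem adj_eq_sum {n k : ℕ} (hkn : 2 * k < n) (i j : Fin n) :
    adj n k i j =
      ∑ e ∈ (Icc (-k : ℤ) k).erase 0, if (n : ℤ) ∣ (i : ℕ) + e - (j : ℕ) then 1 else 0 := by
  classical
  rw [adj, SimpleGraph.adjMatrix_apply]
  split_ifs with hij
  · obtain ⟨e, he, hdvd⟩ := (circulant_adj_iff (by omega)).1 hij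
    rw [sum_eq_single_of_mem e he, if_pos hdvd]
    intro e' he' hne
    refine if_neg fun hdvd' => hne (sub_eq_zero.1 (Int.eq_zero_of_abs_lt_dvd (m := n) ?_ ?_))
    · simpa using dvd_sub hdvd' hdvd
    · simp only [mem_erase, mem_Icc] at he he'
      rw [abs_lt]
      omega
  · exact (sum_eq_zero fun e he =>
      if_neg fun hdvd => hij ((circulant_adj_iff (by omega)).2 ⟨e, he, hdvd⟩)).symm

theorem sum_ite_dvd_sub {n : ℕ} (hn : 0 < n) {g : ℤ → ℝ} (hg : Function.Periodic g n) (t : ℤ) :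
    ∑ j : Fin n, (if (n : ℤ) ∣ t - (j : ℕ) then g (j : ℕ) else 0) = g t := by
  have hn' : (0 : ℤ) < n := by exact_mod_cast hn
  have hnonneg := Int.emod_nonneg t hn'.ne'
  have hlt := Int.emod_lt_of_pos t hn'
  have hval : (((t % n).toNat : ℕ) : ℤ) = t % n := Int.toNat_of_nonneg hnonneg
  rw [sum_eq_single_of_mem ⟨(t % n).toNat, by omega⟩ (mem_univ _)]
  · rw [if_pos (by rw [hval]; exact Int.dvd_self_sub_emod), hval, Int.emod_def, mul_comm]
    exact hg.sub_int_mul_eq _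
  · intro j _ hj
    refine if_neg fun hdvd => hj (Fin.ext ?_)
    have hjt : ((j : ℕ) : ℤ) % n = t % n := Int.modEq_iff_dvd.2 hdvd
    rw [Int.emod_eq_of_lt (by omega) (by exact_mod_cast j.2)] at hjt
    simp only
    omega

theorem sum_adj_mul {n k : ℕ} (hkn : 2 * k < n) (i : Fin n) {g : ℤ → ℝ}
    (hg : Function.Periodic g n) (hi : g (i : ℕ) = 0) :
    ∑ j, adj n k i j * g (j : ℕ) = ∑ e ∈ Icc (-k : ℤ) k, g ((i : ℕ) + e) := by
  rw [← sum_erase (Icc (-k : ℤ) k) (a := 0) (by rw [add_zero, hi])]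
  simp only [adj_eq_sum hkn, sum_mul, ite_mul, one_mul, zero_mul]
  rw [sum_comm]
  exact sum_congr rfl fun e _ => sum_ite_dvd_sub (by omega) hg _

theorem sum_Icc_neg_neg (k : ℕ) (F : ℤ → ℝ) :
    ∑ e ∈ Icc (-k : ℤ) k, F (-e) = ∑ e ∈ Icc (-k : ℤ) k, F e :=
  sum_equiv (Equiv.neg ℤ) (fun e => by simp only [mem_Icc, Equiv.neg_apply]; omega) fun _ _ => rfl

theorem two_mul_sum_Icc_neg (k : ℕ) (F : ℤ → ℝ) :
    2 * ∑ e ∈ Icc (-k : ℤ) k, F e = ∑ e ∈ Icc (-k : ℤ) k, (F e + F (-e)) := by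
  rw [sum_add_distrib, sum_Icc_neg_neg, two_mul]

theorem periodic_natCast_mul_two_pi_div {n : ℕ} (hn : 0 < n) {f : ℝ → ℝ}
    (hf : Function.Periodic f (2 * π)) (m : ℕ) :
    Function.Periodic (fun t : ℤ => f (m * (2 * π * t / n))) n := by
  intro t
  have harg : (m : ℝ) * (2 * π * ((t + n : ℤ) : ℝ) / n) = m * (2 * π * t / n) + m * (2 * π) := by
    push_cast
    field_simp
  simp only [harg]
  exact hf.nat_mul m _

theorem isEquilibrium_smul_twisted {n k : ℕ} (hkn : 2 * k < n) (K : ℝ) (p : ℕ) :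
    IsEquilibrium K (adj n k) ((p : ℝ) • twisted n) := by
  funext i
  let g : ℤ → ℝ := fun t => sin (p * (2 * π * ((t - (i : ℕ) : ℤ) : ℝ) / n))
  have hg : Function.Periodic g n :=
    (periodic_natCast_mul_two_pi_div (by omega) sin_periodic p).sub_const _
  have hterm : ∀ j : Fin n,
      sin (((p : ℝ) • twisted n) j - ((p : ℝ) • twisted n) i) = g (j : ℕ) := by
    intro j
    simp only [g, twisted, Pi.smul_apply, smul_eq_mul]
    congr 1
    push_cast
    ring
  have hodd : 2 * ∑ e ∈ Icc (-k : ℤ) k, g ((i : ℕ) + e) = 0 := by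
    rw [two_mul_sum_Icc_neg]
    refine sum_eq_zero fun e _ => ?_
    simp only [g, add_sub_cancel_left]
    rw [Int.cast_neg, mul_neg, neg_div, mul_neg, sin_neg, add_neg_cancel]
  simp only [field, hterm, Pi.zero_apply]
  rw [sum_adj_mul hkn i hg (by simp [g]), (mul_eq_zero.1 hodd).resolve_left two_ne_zero, mul_zero]

/-! ### Fourier modes -/

/-- The real Fourier mode `cos (2π m i / n)`. -/
noncomputable def cosMode (n m : ℕ) : Fin n → ℝ := fun i => cos (m * twisted n i)

/-- The real Fourier mode `sin (2π m i / n)`. -/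
noncomputable def sinMode (n m : ℕ) : Fin n → ℝ := fun i => sin (m * twisted n i)

/-- The eigenvalue at the Fourier mode `m` of the linearization at the state `2π p i / n` on the
circulant graph. It is defined for real `p` and `m` so that it can be evaluated at differences. -/
noncomputable def modeEigenvalue (n k : ℕ) (p m : ℝ) : ℝ :=
  ∑ e ∈ Icc (-k : ℤ) k, cos (p * (2 * π * e / n)) * (1 - cos (m * (2 * π * e / n)))

theorem linearization_smul_twisted_mode {n k : ℕ} (hkn : 2 * k < n) (p m : ℕ) {f : ℝ → ℝ}
    (hf : Function.Periodic f (2 * π)) (hadd : ∀ x y, f (x + y) + f (x - y) = 2 * f x * cos y) :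
    linearization (adj n k) ((p : ℝ) • twisted n) (fun i => f (m * twisted n i)) =
      modeEigenvalue n k p m • fun i => f (m * twisted n i) := by
  funext i
  let g : ℤ → ℝ := fun t => cos (p * (2 * π * ((t - (i : ℕ) : ℤ) : ℝ) / n)) *
    (f (m * twisted n i) - f (m * (2 * π * t / n)))
  have hg : Function.Periodic g n :=
    ((periodic_natCast_mul_two_pi_div (by omega) cos_periodic p).sub_const _).mul
      (Function.Periodic.sub (fun _ => rfl) (periodic_natCast_mul_two_pi_div (by omega) hf m))
  have hsum : linearization (adj n k) ((p : ℝ) • twisted n) (fun i => f (m * twisted n i)) i =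
      ∑ j, adj n k i j * g (j : ℕ) := by
    refine sum_congr rfl fun j _ => ?_
    simp only [g, twisted, Pi.smul_apply, smul_eq_mul, Int.cast_sub, Int.cast_natCast]
    rw [mul_assoc]
    congr 4
    ring
  have hshift : ∀ e : ℤ, g ((i : ℕ) + e) = cos (p * (2 * π * e / n)) *
      (f (m * twisted n i) - f (m * twisted n i + m * (2 * π * e / n))) := by
    intro e
    simp only [g, twisted, add_sub_cancel_left]
    congr 3
    push_cast
    ring
  refine mul_left_cancel₀ (two_ne_zero (α := ℝ)) ?_
  simp only [Pi.smul_apply, smul_eq_mul, modeEigenvalue]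
  rw [hsum, sum_adj_mul hkn i hg (by simp [g, twisted]), two_mul_sum_Icc_neg, sum_mul, mul_sum]
  refine sum_congr rfl fun e _ => ?_
  rw [hshift, hshift, Int.cast_neg, mul_neg, neg_div, mul_neg, mul_neg, cos_neg, ← sub_eq_add_neg]
  linear_combination (-cos (p * (2 * π * e / n))) * hadd (m * twisted n i) (m * (2 * π * e / n))

theorem linearization_smul_twisted_cosMode {n k : ℕ} (hkn : 2 * k < n) (p m : ℕ) :
    linearization (adj n k) ((p : ℝ) • twisted n) (cosMode n m) =
      modeEigenvalue n k p m • cosMode n m :=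
  linearization_smul_twisted_mode hkn p m cos_periodic fun x y => by rw [cos_add, cos_sub]; ring

theorem linearization_smul_twisted_sinMode {n k : ℕ} (hkn : 2 * k < n) (p m : ℕ) :
    linearization (adj n k) ((p : ℝ) • twisted n) (sinMode n m) =
      modeEigenvalue n k p m • sinMode n m :=
  linearization_smul_twisted_mode hkn p m sin_periodic fun x y => by rw [sin_add, sin_sub]; ring

theorem two_mul_sin_half_mul_sum_range_cos (b : ℝ) (N : ℕ) :
    2 * sin (b / 2) * ∑ m ∈ range N, cos (m * b) = sin (N * b - b / 2) + sin (b / 2) := by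
  induction N with
  | zero => simp
  | succ N ih =>
    have hlast : ((N + 1 : ℕ) : ℝ) * b - b / 2 = N * b + b / 2 := by push_cast; ring
    rw [sum_range_succ, mul_add, ih, hlast, sin_sub, sin_add]
    ring

theorem sin_pi_mul_div_ne_zero {n : ℕ} {t : ℤ} (ht₀ : t ≠ 0) (ht : |t| < n) :
    sin (π * t / n) ≠ 0 := by
  have hn : (n : ℝ) ≠ 0 := by
    have := abs_nonneg t
    exact_mod_cast (by omega : n ≠ 0)
  intro hsin
  obtain ⟨a, ha⟩ := sin_eq_zero_iff.1 hsin
  have hat : ((n * a : ℤ) : ℝ) = t := by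
    field_simp at ha
    push_cast
    rw [mul_comm, ha]
  exact ht₀ (Int.eq_zero_of_abs_lt_dvd ⟨a, by exact_mod_cast hat.symm⟩ ht)

theorem sum_range_cos_mul_twisted_sub {n : ℕ} (i j : Fin n) :
    ∑ m ∈ range n, cos (m * (twisted n i - twisted n j)) = if i = j then (n : ℝ) else 0 := by
  have hn : (n : ℝ) ≠ 0 := by
    have := i.2
    exact_mod_cast (by omega : n ≠ 0)
  split_ifs with hij
  · simp [hij]
  let t : ℤ := (i : ℕ) - (j : ℕ)
  have ht : t ≠ 0 := fun ht => hij (Fin.ext (by omega))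
  have hdiff : twisted n i - twisted n j = 2 * (π * t / n) := by
    simp only [twisted, t]
    push_cast
    ring
  have hsin : sin (π * t / n) ≠ 0 := sin_pi_mul_div_ne_zero ht (by rw [abs_lt]; omega)
  have hsum := two_mul_sin_half_mul_sum_range_cos (twisted n i - twisted n j) n
  have hturn : (n : ℝ) * (2 * (π * t / n)) = t * (2 * π) := by field_simp
  rw [hdiff, mul_div_cancel_left₀ _ (two_ne_zero (α := ℝ)), hturn, sub_eq_neg_add,
    sin_add_int_mul_two_pi, sin_neg, neg_add_cancel] at hsum
  rw [hdiff]
  exact (mul_eq_zero.1 hsum).resolve_left (mul_ne_zero two_ne_zero hsin)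

theorem sum_modes_dotProduct_mul {n : ℕ} (u v : Fin n → ℝ) :
    ∑ m ∈ range n, ((cosMode n m ⬝ᵥ u) * (cosMode n m ⬝ᵥ v) +
      (sinMode n m ⬝ᵥ u) * (sinMode n m ⬝ᵥ v)) = n * (u ⬝ᵥ v) := by
  have hmode : ∀ m, (cosMode n m ⬝ᵥ u) * (cosMode n m ⬝ᵥ v) +
      (sinMode n m ⬝ᵥ u) * (sinMode n m ⬝ᵥ v) =
      ∑ i, ∑ j, cos (m * (twisted n i - twisted n j)) * (u i * v j) := by
    intro m
    simp only [dotProduct, sum_mul_sum, cosMode, sinMode, ← sum_add_distrib]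
    refine sum_congr rfl fun i _ => sum_congr rfl fun j _ => ?_
    rw [mul_sub, cos_sub]
    ring
  calc _ = ∑ i, ∑ j, (∑ m ∈ range n, cos (m * (twisted n i - twisted n j))) * (u i * v j) := by
        simp only [hmode, sum_mul]
        rw [sum_comm]
        exact sum_congr rfl fun i _ => sum_comm
    _ = n * (u ⬝ᵥ v) := by
        simp only [sum_range_cos_mul_twisted_sub, ite_mul, zero_mul, sum_ite_eq, mem_univ, if_true,
          dotProduct, mul_sum]

theorem cosMode_ne_zero {n : ℕ} (hn : 0 < n) (m : ℕ) : cosMode n m ≠ 0 := by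
  intro hzero
  have hone := congrFun hzero ⟨0, hn⟩
  simp [cosMode, twisted] at hone

theorem cosMode_zero (n : ℕ) : cosMode n 0 = 1 := by
  funext i
  simp [cosMode]

theorem sinMode_zero (n : ℕ) : sinMode n 0 = 0 := by
  funext i
  simp [sinMode]

section Linearization

variable {n k : ℕ} (hkn : 2 * k < n) (p m : ℕ) (u : Fin n → ℝ)
include hkn

theorem cosMode_dotProduct_linearization :
    cosMode n m ⬝ᵥ linearization (adj n k) ((p : ℝ) • twisted n) u =
      modeEigenvalue n k p m * (cosMode n m ⬝ᵥ u) := by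
  rw [dotProduct_linearization_comm (adj_isSymm n k), linearization_smul_twisted_cosMode hkn,
    dotProduct_smul, smul_eq_mul, dotProduct_comm]

theorem sinMode_dotProduct_linearization :
    sinMode n m ⬝ᵥ linearization (adj n k) ((p : ℝ) • twisted n) u =
      modeEigenvalue n k p m * (sinMode n m ⬝ᵥ u) := by
  rw [dotProduct_linearization_comm (adj_isSymm n k), linearization_smul_twisted_sinMode hkn,
    dotProduct_smul, smul_eq_mul, dotProduct_comm]

end Linearization

theorem hasSpectralGap_smul_twisted {n k : ℕ} (hkn : 2 * k < n) (p : ℕ) {γ : ℝ}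
    (hγ : ∀ m : ℕ, 1 ≤ m → m < n → γ ≤ modeEigenvalue n k p m) :
    HasSpectralGap (adj n k) ((p : ℝ) • twisted n) γ := by
  intro u hu
  have hn : (0 : ℝ) < n := by exact_mod_cast (by omega : 0 < n)
  refine le_of_mul_le_mul_left ?_ hn
  rw [mul_left_comm, ← sum_modes_dotProduct_mul, ← sum_modes_dotProduct_mul, mul_sum]
  refine sum_le_sum fun m hm => ?_
  rw [cosMode_dotProduct_linearization hkn, sinMode_dotProduct_linearization hkn]
  rcases Nat.eq_zero_or_pos m with rfl | hm₀
  · simp [cosMode_zero, sinMode_zero, one_dotProduct, hu]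
  · have hle := hγ m hm₀ (mem_range.1 hm)
    rw [mul_left_comm, mul_left_comm (sinMode n m ⬝ᵥ u), ← mul_add]
    exact mul_le_mul_of_nonneg_right hle (add_nonneg (mul_self_nonneg _) (mul_self_nonneg _))

/-! ### Laplacian eigenvalues -/

/-- The eigenvalue of the graph Laplacian at the Fourier mode `m`, for real `m`. -/
noncomputable def lapEigenvalue (n k : ℕ) (m : ℝ) : ℝ :=
  ∑ e ∈ Icc (-k : ℤ) k, (1 - cos (m * (2 * π * e / n)))

theorem modeEigenvalue_zero (n k : ℕ) (m : ℝ) :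
    modeEigenvalue n k 0 m = lapEigenvalue n k m := by
  simp [modeEigenvalue, lapEigenvalue]

theorem modeEigenvalue_one (n k : ℕ) (m : ℝ) :
    modeEigenvalue n k 1 m =
      (lapEigenvalue n k (m + 1) + lapEigenvalue n k (m - 1)) / 2 - lapEigenvalue n k 1 := by
  simp only [modeEigenvalue, lapEigenvalue]
  rw [← sum_add_distrib, sum_div, ← sum_sub_distrib]
  refine sum_congr rfl fun e _ => ?_
  rw [add_mul, sub_mul, cos_add, cos_sub, one_mul]
  ring

theorem lapEigenvalue_zero (n k : ℕ) : lapEigenvalue n k 0 = 0 := by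
  simp [lapEigenvalue]

theorem modeEigenvalue_one_one (n k : ℕ) :
    modeEigenvalue n k 1 1 = lapEigenvalue n k 2 / 2 - lapEigenvalue n k 1 := by
  rw [modeEigenvalue_one, sub_self, lapEigenvalue_zero, add_zero, one_add_one_eq_two]

theorem lapEigenvalue_natCast_sub {n : ℕ} (hn : 0 < n) (k : ℕ) (m : ℝ) :
    lapEigenvalue n k (n - m) = lapEigenvalue n k m := by
  refine sum_congr rfl fun e _ => ?_
  have hturn : (n - m) * (2 * π * e / n) = e * (2 * π) - m * (2 * π * e / n) := by field_simp
  rw [hturn, cos_int_mul_two_pi_sub]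

theorem sin_mul_sum_Icc_neg_cos (x : ℝ) (k : ℕ) :
    sin x * ∑ e ∈ Icc (-k : ℤ) k, cos (2 * e * x) = sin ((2 * k + 1) * x) := by
  induction k with
  | zero => simp
  | succ k ih =>
    have hleft : (2 * (k : ℝ) + 1) * x = 2 * (k + 1) * x - x := by ring
    have hright : (2 * ((k : ℝ) + 1) + 1) * x = 2 * (k + 1) * x + x := by ring
    rw [Nat.cast_add, Nat.cast_one, sum_Icc_succ_eq_add_endpoints, mul_add, ih]
    push_cast
    rw [mul_neg, neg_mul, cos_neg, hleft, hright, sin_sub, sin_add]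
    ring

theorem sin_mul_lapEigenvalue (n k : ℕ) (m : ℝ) :
    sin (m * (π / n)) * lapEigenvalue n k m =
      (2 * k + 1) * sin (m * (π / n)) - sin ((2 * k + 1) * (m * (π / n))) := by
  have hangle : ∀ e : ℤ, m * (2 * π * e / n) = 2 * e * (m * (π / n)) := fun e => by ring
  have hcard : (#(Icc (-k : ℤ) k) : ℝ) = 2 * k + 1 := by
    rw [Int.card_Icc]
    exact_mod_cast (by omega : ((k : ℤ) + 1 - -k).toNat = 2 * k + 1)
  simp only [lapEigenvalue, hangle]
  rw [sum_sub_distrib, mul_sub, sin_mul_sum_Icc_neg_cos, sum_const, nsmul_one, hcard, mul_comm]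

theorem mul_pi_div_le {n : ℕ} (hn : 0 < n) {a c : ℝ} (h : a ≤ c * n) : a * (π / n) ≤ c * π := by
  rw [mul_div_left_comm, mul_comm c]
  exact mul_le_mul_of_nonneg_left ((div_le_iff₀ (by positivity)).2 h) pi_pos.le

theorem le_mul_pi_div {n : ℕ} (hn : 0 < n) {a c : ℝ} (h : c * n ≤ a) : c * π ≤ a * (π / n) := by
  rw [mul_div_left_comm, mul_comm c]
  exact mul_le_mul_of_nonneg_left ((le_div_iff₀ (by positivity)).2 h) pi_pos.le

theorem sin_natCast_mul_pi_div_pos {n m : ℕ} (hm : 1 ≤ m) (hmn : m < n) :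
    0 < sin (m * (π / n)) := by
  have hm' : (0 : ℝ) < m := by exact_mod_cast hm
  have hmn' : (m : ℝ) < n := by exact_mod_cast hmn
  refine sin_pos_of_pos_of_lt_pi (mul_pos hm' (div_pos pi_pos (hm'.trans hmn'))) ?_
  rw [mul_div_left_comm]
  exact mul_lt_of_lt_one_right pi_pos ((div_lt_one (hm'.trans hmn')).2 hmn')

theorem lapEigenvalue_natCast {n m : ℕ} (k : ℕ) (hm : 1 ≤ m) (hmn : m < n) :
    lapEigenvalue n k m = (2 * k + 1) - sin ((2 * k + 1) * (m * (π / n))) / sin (m * (π / n)) := by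
  have hsin := (sin_natCast_mul_pi_div_pos hm hmn).ne'
  rw [eq_sub_iff_add_eq, ← eq_sub_iff_add_eq', div_eq_iff hsin]
  linear_combination sin_mul_lapEigenvalue n k m

theorem lapEigenvalue_pos {n k m : ℕ} (hk : 1 ≤ k) (hm : 1 ≤ m) (hmn : m < n) :
    0 < lapEigenvalue n k m := by
  have hsin := sin_natCast_mul_pi_div_pos hm hmn
  have hone : (m : ℝ) * (2 * π * (1 : ℤ) / n) = 2 * (m * (π / n)) := by push_cast; ring
  refine sum_pos' (fun e _ => sub_nonneg.2 (cos_le_one _)) ⟨1, by rw [mem_Icc]; omega, ?_⟩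
  rw [hone, cos_two_mul, cos_sq']
  nlinarith

/-! ### The smallest nonzero eigenvalue -/

theorem sin_mul_sum_range_cos (r : ℕ) (t : ℝ) :
    sin t * ∑ j ∈ range r, cos ((r - 1 - 2 * j) * t) = sin (r * t) := by
  have hterm : ∀ j : ℕ, sin t * cos ((r - 1 - 2 * j) * t) =
      sin ((r - 2 * j) * t) / 2 - sin ((r - 2 * (j + 1 : ℕ)) * t) / 2 := by
    intro j
    have hleft : (r - 2 * (j : ℝ)) * t = (r - 1 - 2 * j) * t + t := by ring
    have hright : (r - 2 * ((j + 1 : ℕ) : ℝ)) * t = (r - 1 - 2 * j) * t - t := by push_cast; ring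
    rw [hleft, hright, sin_add, sin_sub]
    ring
  have hend : (r - 2 * (r : ℝ)) * t = -(r * t) := by ring
  rw [mul_sum, sum_congr rfl fun j _ => hterm j,
    sum_range_sub' fun j : ℕ => sin ((r - 2 * (j : ℝ)) * t) / 2, hend, sin_neg]
  simp only [Nat.cast_zero]
  ring_nf

theorem sin_natCast_mul_mul_sin_lt {r : ℕ} (hr : 2 ≤ r) {s t : ℝ} (hs : 0 < s) (hst : s < t)
    (hrt : r * t ≤ π) : sin (r * t) * sin s < sin (r * s) * sin t := by
  have hr' : (2 : ℝ) ≤ r := by exact_mod_cast hr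
  have hfreq : ∀ j ∈ range r, |(r - 1 - 2 * j : ℝ)| ≤ r - 1 := by
    intro j hj
    have hjr : (j : ℝ) + 1 ≤ r := by exact_mod_cast mem_range.1 hj
    rw [abs_le]
    constructor <;> linarith [(j.cast_nonneg : (0 : ℝ) ≤ j)]
  have hbound : ∀ j ∈ range r, |(r - 1 - 2 * j) * t| ≤ π := by
    intro j hj
    rw [abs_mul, abs_of_pos (hs.trans hst)]
    nlinarith [hfreq j hj]
  have habs : ∀ a : ℝ, |a * s| ≤ |a * t| := by
    intro a
    rw [abs_mul, abs_mul, abs_of_pos hs, abs_of_pos (hs.trans hst)]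
    exact mul_le_mul_of_nonneg_left hst.le (abs_nonneg a)
  have hsum : ∑ j ∈ range r, cos ((r - 1 - 2 * j) * t) <
      ∑ j ∈ range r, cos ((r - 1 - 2 * j) * s) := by
    refine sum_lt_sum (fun j hj => ?_) ⟨0, mem_range.2 (by omega), ?_⟩
    · rw [← cos_abs, ← cos_abs (_ * s)]
      exact cos_le_cos_of_nonneg_of_le_pi (abs_nonneg _) (hbound j hj) (habs _)
    · rw [Nat.cast_zero, mul_zero, sub_zero]
      exact cos_lt_cos_of_nonneg_of_le_pi (by nlinarith) (by nlinarith) (by nlinarith)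
  have hsin_s : 0 < sin s := sin_pos_of_pos_of_lt_pi hs (by nlinarith)
  have hsin_t : 0 < sin t := sin_pos_of_pos_of_lt_pi (hs.trans hst) (by nlinarith)
  rw [← sin_mul_sum_range_cos, ← sin_mul_sum_range_cos]
  nlinarith [mul_lt_mul_of_pos_left hsum (mul_pos hsin_s hsin_t)]

theorem natCast_mul_pi_div_le_half {n m : ℕ} (hn : 0 < n) (hm : 2 * m ≤ n) :
    m * (π / n) ≤ π / 2 := by
  have hm' : (2 : ℝ) * m ≤ n := by exact_mod_cast hm
  linarith [mul_pi_div_le (a := m) (c := 1 / 2) hn (by linarith)]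

theorem sin_pi_div_lt_sin_mul_sin {n r m : ℕ} (hn : 0 < n) (hr : 2 * r ≤ n) (hm : 2 * m ≤ n)
    (hrm : n ≤ r * m) : sin (π / n) < sin (r * (π / n)) * sin (m * (π / n)) := by
  have hn' : (0 : ℝ) < n := by exact_mod_cast hn
  have hrm' : (n : ℝ) ≤ r * m := by exact_mod_cast hrm
  have hjordan : ∀ j : ℕ, 2 * j ≤ n → 2 * (j / n : ℝ) ≤ sin (j * (π / n)) := by
    intro j hj
    refine le_trans (le_of_eq ?_) (mul_le_sin (by positivity) (natCast_mul_pi_div_le_half hn hj))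
    field_simp
  calc sin (π / n) < π / n := sin_lt (by positivity)
    _ < 4 / n := by gcongr; exact pi_lt_four
    _ ≤ 4 * (r * m) / (n * n) := by
        rw [div_le_div_iff₀ hn' (by positivity)]
        nlinarith
    _ = 2 * (r / n) * (2 * (m / n)) := by ring
    _ ≤ sin (r * (π / n)) * sin (m * (π / n)) :=
        mul_le_mul (hjordan r hr) (hjordan m hm) (by positivity)
          (le_trans (by positivity) (hjordan r hr))

theorem sin_natCast_sub_mul_pi_div {n r : ℕ} (hn : 0 < n) (hr : r ≤ n) :
    sin ((n - r : ℕ) * (π / n)) = sin (r * (π / n)) := by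
  have hangle : ((n - r : ℕ) : ℝ) * (π / n) = π - r * (π / n) := by
    rw [Nat.cast_sub hr]
    field_simp
  rw [hangle, sin_pi_sub]

theorem abs_sin_natCast_sub_mul_pi_div {n r : ℕ} (hn : 0 < n) (hr : r ≤ n) (m : ℕ) :
    |sin ((n - r : ℕ) * (m * (π / n)))| = |sin (r * (m * (π / n)))| := by
  have hangle : ((n - r : ℕ) : ℝ) * (m * (π / n)) = m * π - r * (m * (π / n)) := by
    rw [Nat.cast_sub hr]
    field_simp
  rw [hangle, sin_nat_mul_pi_sub, abs_neg, abs_mul, abs_pow, abs_neg, abs_one, one_pow, one_mul]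

theorem abs_sin_mul_sin_pi_div_lt_of_two_mul_le {n r m : ℕ} (hr : 2 ≤ r) (hrn : 2 * r ≤ n)
    (hm : 2 ≤ m) (hmn : 2 * m ≤ n) :
    |sin (r * (m * (π / n)))| * sin (π / n) < sin (r * (π / n)) * sin (m * (π / n)) := by
  have hn : 0 < n := by omega
  have hangle : 0 < π / n := by positivity
  rcases le_total (r * m) n with hrm | hrm
  · have hle : (r : ℝ) * (m * (π / n)) ≤ π := by
      have := mul_pi_div_le (a := r * m) (c := 1) hn (by rw [one_mul]; exact_mod_cast hrm)
      rwa [mul_assoc, one_mul] at this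
    have hm' : (1 : ℝ) < m := by exact_mod_cast hm
    rw [abs_of_nonneg (sin_nonneg_of_nonneg_of_le_pi (by positivity) hle)]
    exact sin_natCast_mul_mul_sin_lt hr hangle (lt_mul_of_one_lt_left hangle hm') hle
  · have hsin := sin_nonneg_of_nonneg_of_le_pi hangle.le (div_le_self pi_pos.le (by
      exact_mod_cast hn))
    exact (mul_le_of_le_one_left hsin (abs_sin_le_one _)).trans_lt
      (sin_pi_div_lt_sin_mul_sin hn hrn hmn hrm)

theorem abs_sin_mul_sin_pi_div_lt {n r m : ℕ} (hr : 2 ≤ r) (hrn : r + 2 ≤ n) (hm : 2 ≤ m)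
    (hmn : m + 2 ≤ n) :
    |sin (r * (m * (π / n)))| * sin (π / n) < sin (r * (π / n)) * sin (m * (π / n)) := by
  have hn : 0 < n := by omega
  wlog hr₂ : 2 * r ≤ n generalizing r
  · have := this (r := n - r) (by omega) (by omega) (by omega)
    rwa [abs_sin_natCast_sub_mul_pi_div hn (by omega),
      sin_natCast_sub_mul_pi_div hn (by omega)] at this
  wlog hm₂ : 2 * m ≤ n generalizing m
  · have := this (m := n - m) (by omega) (by omega) (by omega)
    rwa [mul_left_comm, abs_sin_natCast_sub_mul_pi_div hn (by omega),
      sin_natCast_sub_mul_pi_div hn (by omega), mul_left_comm] at this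
  exact abs_sin_mul_sin_pi_div_lt_of_two_mul_le hr hr₂ hm hm₂

theorem abs_sin_mul_sin_pi_div_le {n r m : ℕ} (hn : 0 < n) (hrn : r ≤ n) (hm : 1 ≤ m)
    (hmn : m < n) :
    |sin (r * (m * (π / n)))| * sin (π / n) ≤ sin (r * (π / n)) * sin (m * (π / n)) := by
  wlog hr₂ : 2 * r ≤ n generalizing r
  · have := this (r := n - r) (by omega) (by omega)
    rwa [abs_sin_natCast_sub_mul_pi_div hn hrn, sin_natCast_sub_mul_pi_div hn hrn] at this
  wlog hm₂ : 2 * m ≤ n generalizing m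
  · have := this (m := n - m) (by omega) (by omega) (by omega)
    rwa [mul_left_comm, abs_sin_natCast_sub_mul_pi_div hn hmn.le,
      sin_natCast_sub_mul_pi_div hn hmn.le, mul_left_comm] at this
  have hsin : ∀ j : ℕ, 2 * j ≤ n → 0 ≤ sin (j * (π / n)) := fun j hj =>
    sin_nonneg_of_nonneg_of_le_pi (by positivity)
      ((natCast_mul_pi_div_le_half hn hj).trans (by linarith [pi_pos]))
  obtain rfl | rfl | rfl | ⟨hr, hm⟩ : r = 0 ∨ r = 1 ∨ m = 1 ∨ (2 ≤ r ∧ 2 ≤ m) := by omega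
  · simp
  · simp only [Nat.cast_one, one_mul]
    rw [abs_of_nonneg (hsin m hm₂), mul_comm]
  · simp only [Nat.cast_one, one_mul]
    rw [abs_of_nonneg (hsin r hr₂)]
  · exact (abs_sin_mul_sin_pi_div_lt_of_two_mul_le hr hr₂ hm hm₂).le

theorem lapEigenvalue_one {n : ℕ} (k : ℕ) (hn : 2 ≤ n) :
    lapEigenvalue n k 1 = (2 * k + 1) - sin ((2 * k + 1) * (π / n)) / sin (π / n) := by
  simpa using lapEigenvalue_natCast k (m := 1) le_rfl hn

theorem sin_pi_div_pos {n : ℕ} (hn : 2 ≤ n) : 0 < sin (π / n) := by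
  simpa using sin_natCast_mul_pi_div_pos (m := 1) le_rfl hn

theorem lapEigenvalue_one_le {n k m : ℕ} (hkn : 2 * k < n) (hm : 1 ≤ m) (hmn : m < n) :
    lapEigenvalue n k 1 ≤ lapEigenvalue n k m := by
  have hsin := abs_sin_mul_sin_pi_div_le (r := 2 * k + 1) (by omega) hkn hm hmn
  have hpos := sin_pi_div_pos (n := n) (by omega)
  push_cast at hsin
  rw [lapEigenvalue_natCast k hm hmn, lapEigenvalue_one k (by omega), sub_le_sub_iff_left,
    div_le_div_iff₀ (sin_natCast_mul_pi_div_pos hm hmn) hpos]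
  exact (mul_le_mul_of_nonneg_right (le_abs_self _) hpos.le).trans hsin

theorem lapEigenvalue_one_lt {n k m : ℕ} (hk : 1 ≤ k) (hkn : 2 * k + 3 ≤ n) (hm : 2 ≤ m)
    (hmn : m + 2 ≤ n) : lapEigenvalue n k 1 < lapEigenvalue n k m := by
  have hsin := abs_sin_mul_sin_pi_div_lt (r := 2 * k + 1) (by omega) hkn hm hmn
  have hpos := sin_pi_div_pos (n := n) (by omega)
  push_cast at hsin
  rw [lapEigenvalue_natCast k (by omega) (by omega), lapEigenvalue_one k (by omega),
    sub_lt_sub_iff_left, div_lt_div_iff₀ (sin_natCast_mul_pi_div_pos (by omega) (by omega)) hpos]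
  exact (mul_le_mul_of_nonneg_right (le_abs_self _) hpos.le).trans_lt hsin

/-! ### Comparison of the eigenvalues -/

theorem lapEigenvalue_two {n : ℕ} (k : ℕ) (hn : 3 ≤ n) :
    lapEigenvalue n k 2 =
      (2 * k + 1) - sin (2 * ((2 * k + 1) * (π / n))) / sin (2 * (π / n)) := by
  rw [mul_left_comm]
  exact_mod_cast lapEigenvalue_natCast k (m := 2) (by omega) hn

theorem two_mul_lapEigenvalue_one_lt_of_four_mul_lt {n k : ℕ} (hk : 1 ≤ k) (hkn : 4 * k < n) :
    2 * lapEigenvalue n k 1 < lapEigenvalue n k 2 := by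
  have hn : (0 : ℝ) < n := by exact_mod_cast (by omega : 0 < n)
  have hangle : ∀ e ∈ Icc (-k : ℤ) k, |2 * π * e / n| < π / 2 := by
    intro e he
    have hen : 4 * |(e : ℝ)| < n := by
      rw [mem_Icc, ← abs_le] at he
      exact_mod_cast (by omega : 4 * |e| < n)
    rw [abs_div, abs_mul, abs_of_pos two_pi_pos, Nat.abs_cast, div_lt_iff₀ hn]
    nlinarith [pi_pos]
  suffices hpos : 0 < modeEigenvalue n k 1 1 by
    rw [modeEigenvalue_one_one] at hpos
    linarith
  simp only [modeEigenvalue, one_mul]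
  refine sum_pos' (fun e he => ?_) ⟨1, by rw [mem_Icc]; omega, ?_⟩
  · exact mul_nonneg (cos_nonneg_of_mem_Icc (abs_le.1 (hangle e he).le))
      (sub_nonneg.2 (cos_le_one _))
  · have hlt := hangle 1 (by rw [mem_Icc]; omega)
    refine mul_pos (cos_pos_of_mem_Ioo (abs_lt.1 hlt)) (sub_pos.2 ?_)
    rw [← cos_zero, ← cos_abs (2 * π * (1 : ℤ) / n)]
    exact cos_lt_cos_of_nonneg_of_le_pi le_rfl (by linarith [pi_pos]) (by positivity)

theorem add_sin_two_mul_div_lt {q x : ℝ} (hx : 0 < x) (hx₂ : 2 * x < π)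
    (hlo : 1 / 2 * π ≤ q * x) (hhi : q * x ≤ 0.6 * π) :
    q + sin (2 * (q * x)) / sin (2 * x) < 2 * (sin (q * x) / sin x) := by
  have hq : 0 < q := pos_of_mul_pos_left (by linarith [pi_pos]) hx.le
  have hpi := pi_lt_d2
  have hsin_x : 0 < sin x := sin_pos_of_pos_of_lt_pi hx (by linarith)
  have hsin_two_x : 0 < sin (2 * x) := sin_pos_of_pos_of_lt_pi (by linarith) hx₂
  have hsin_two : sin (2 * (q * x)) ≤ 0 := by
    rw [← neg_nonneg, ← sin_sub_pi]
    exact sin_nonneg_of_nonneg_of_le_pi (by linarith) (by linarith [pi_pos])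
  have hsin : q * x < 2 * sin (q * x) := by
    have hcos := one_sub_sq_div_two_le_cos (x := q * x - π / 2)
    rw [cos_sub_pi_div_two] at hcos
    nlinarith
  have hmain : q < 2 * (sin (q * x) / sin x) := by
    rw [mul_div_assoc', lt_div_iff₀ hsin_x]
    exact (mul_le_mul_of_nonneg_left (sin_le hx.le) hq.le).trans_lt hsin
  linarith [div_nonpos_of_nonpos_of_nonneg hsin_two hsin_two_x.le]

theorem two_mul_lapEigenvalue_one_lt_of_le {n k : ℕ} (hk : 1 ≤ k)
    (hd : (2 * k + 1 : ℝ) ≤ 0.6 * n) : 2 * lapEigenvalue n k 1 < lapEigenvalue n k 2 := by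
  rcases lt_or_ge (4 * k) n with hkn | hkn
  · exact two_mul_lapEigenvalue_one_lt_of_four_mul_lt hk hkn
  have hkn' : (n : ℝ) ≤ 4 * k := by exact_mod_cast hkn
  have hn : 5 ≤ n := by exact_mod_cast (by
    have : (1 : ℝ) ≤ k := by exact_mod_cast hk
    linarith : (5 : ℝ) ≤ n)
  have hangle : 2 * (π / n) < π := by
    have : (5 : ℝ) ≤ n := by exact_mod_cast hn
    have := mul_pi_div_le (n := n) (a := 2) (c := 2 / 5) (by omega) (by linarith)
    linarith [pi_pos]
  have htrig := add_sin_two_mul_div_lt (q := 2 * k + 1) (by positivity) hangle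
    (le_mul_pi_div (by omega) (by linarith)) (mul_pi_div_le (by omega) hd)
  rw [lapEigenvalue_one k (by omega), lapEigenvalue_two k (by omega)]
  linarith

theorem lt_sin_pi_div_five : 0.55 < sin (π / 5) := by
  have hlo := pi_gt_d2
  have hhi := pi_lt_d2
  have hcube := sin_gt_sub_cube (x := π / 5) (by linarith)
  nlinarith [pow_le_pow_left₀ (by linarith) (by linarith : π / 5 ≤ 0.63) 3]

theorem abs_sin_div_sin_le {n m a : ℕ} (ha : 1 ≤ a) (ham : a ≤ m) (hm : 2 * m ≤ n) (z : ℝ) :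
    |sin z / sin (m * (π / n))| ≤ 1 / sin (a * (π / n)) := by
  have hmono : sin (a * (π / n)) ≤ sin (m * (π / n)) := by
    refine sin_le_sin_of_le_of_le_pi_div_two ?_ (natCast_mul_pi_div_le_half (by omega) hm)
      (by gcongr)
    exact (neg_nonpos.2 (by positivity)).trans (by positivity)
  rw [abs_div, abs_of_pos (sin_natCast_mul_pi_div_pos (ha.trans ham) (by omega))]
  exact div_le_div₀ zero_le_one (abs_sin_le_one z) (sin_natCast_mul_pi_div_pos ha (by omega)) hmono

section MiddleDensity

variable {y : ℝ} (hlo : 0.6 * π ≤ y) (hhi : y ≤ 0.7 * π)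
include hlo hhi

theorem sin_two_mul_le_neg_sin_pi_div_five : sin (2 * y) ≤ -sin (π / 5) := by
  rw [← neg_neg (sin (2 * y)), ← sin_sub_pi, neg_le_neg_iff]
  exact sin_le_sin_of_le_of_le_pi_div_two (by linarith [pi_pos]) (by linarith) (by linarith)

theorem neg_sin_pi_div_five_div_le_sin_three_mul_div {x : ℝ} (hx : 0 < x) (hx₃ : 3 * x ≤ π / 2) :
    -sin (π / 5) / sin (2 * x) ≤ sin (3 * y) / sin (3 * x) := by
  have hsin := lt_sin_pi_div_five
  have hsin_two : 0 < sin (2 * x) := sin_pos_of_pos_of_lt_pi (by linarith) (by linarith)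
  have hmono : sin (2 * x) ≤ sin (3 * x) :=
    sin_le_sin_of_le_of_le_pi_div_two (by linarith) hx₃ (by linarith)
  have hle : -sin (π / 5) ≤ sin (3 * y) := by
    rw [← sin_neg, ← sin_sub_two_pi (3 * y)]
    exact sin_le_sin_of_le_of_le_pi_div_two (by linarith) (by linarith) (by linarith)
  calc -sin (π / 5) / sin (2 * x) ≤ -sin (π / 5) / sin (3 * x) := by
        rw [neg_div, neg_div, neg_le_neg_iff]
        gcongr
    _ ≤ sin (3 * y) / sin (3 * x) := by
        gcongr
        exact hsin_two.le.trans hmono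

end MiddleDensity

theorem neg_sin_pi_div_five_div_le_sin_div {n m : ℕ} (hn : 20 ≤ n) (hm : 4 ≤ m) (hmn : 2 * m ≤ n)
    (z : ℝ) : -sin (π / 5) / sin (2 * (π / n)) ≤ sin z / sin (m * (π / n)) := by
  have hn' : (20 : ℝ) ≤ n := by exact_mod_cast hn
  have hx : 2 * (π / n) ≤ 0.1 * π := mul_pi_div_le (by omega) (by linarith)
  have hx₀ : 0 < 2 * (π / n) := by positivity
  have hpi := pi_lt_d2
  have hsin := lt_sin_pi_div_five
  have hsin_two : 0 < sin (2 * (π / n)) := sin_pos_of_pos_of_lt_pi hx₀ (by linarith)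
  have hcos : 0.91 ≤ cos (2 * (π / n)) := by
    have := one_sub_sq_div_two_le_cos (x := 2 * (π / n))
    nlinarith
  refine le_trans ?_ (neg_le_of_abs_le (abs_sin_div_sin_le (by omega) hm hmn z))
  have hfour : sin ((4 : ℕ) * (π / n)) = 2 * sin (2 * (π / n)) * cos (2 * (π / n)) := by
    rw [← sin_two_mul]
    congr 1
    push_cast
    ring
  rw [hfour, neg_div, neg_le_neg_iff, div_le_div_iff₀ (by positivity) hsin_two]
  nlinarith [mul_le_mul hsin.le hcos (by norm_num) (by linarith)]

theorem lapEigenvalue_le_two {n k m : ℕ} (hn : 20 ≤ n) (hlo : 0.6 * n ≤ (2 * k + 1 : ℝ))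
    (hhi : (2 * k + 1 : ℝ) ≤ 0.7 * n) (hm : 1 ≤ m) (hmn : m < n) :
    lapEigenvalue n k m ≤ lapEigenvalue n k 2 := by
  wlog hm₂ : 2 * m ≤ n generalizing m
  · have := this (m := n - m) (by omega) (by omega) (by omega)
    rwa [Nat.cast_sub hmn.le, lapEigenvalue_natCast_sub (by omega)] at this
  have : (20 : ℝ) ≤ n := by exact_mod_cast hn
  have hlo' := le_mul_pi_div (by omega) hlo
  have hhi' := mul_pi_div_le (by omega) hhi
  have hx₃ : 3 * (π / n) ≤ π / 2 := by
    exact_mod_cast natCast_mul_pi_div_le_half (m := 3) (n := n) (by omega) (by omega)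
  have hsin_two : 0 < sin (2 * (π / n)) := by
    exact_mod_cast sin_natCast_mul_pi_div_pos (m := 2) (n := n) (by omega) (by omega)
  have hsin := lt_sin_pi_div_five
  rw [lapEigenvalue_natCast k hm hmn, lapEigenvalue_two k (by omega), sub_le_sub_iff_left,
    mul_left_comm (2 * k + 1 : ℝ) m]
  set y := (2 * k + 1) * (π / n)
  have htwo : sin (2 * y) / sin (2 * (π / n)) ≤ -sin (π / 5) / sin (2 * (π / n)) :=
    div_le_div_of_nonneg_right (sin_two_mul_le_neg_sin_pi_div_five hlo' hhi') hsin_two.le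
  obtain rfl | rfl | rfl | hm₄ : m = 1 ∨ m = 2 ∨ m = 3 ∨ 4 ≤ m := by omega
  · refine htwo.trans ((div_nonpos_of_nonpos_of_nonneg (by linarith) hsin_two.le).trans ?_)
    rw [Nat.cast_one, one_mul, one_mul]
    exact div_nonneg (sin_nonneg_of_nonneg_of_le_pi (by linarith [pi_pos]) (by linarith [pi_pos]))
      (sin_pi_div_pos (by omega)).le
  · rfl
  · exact htwo.trans (neg_sin_pi_div_five_div_le_sin_three_mul_div hlo' hhi' (by positivity) hx₃)
  · exact htwo.trans (neg_sin_pi_div_five_div_le_sin_div hn hm₄ hm₂ _)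

theorem sin_le_of_le_of_le_pi {y : ℝ} (hlo : 0.7 * π ≤ y) (hhi : y ≤ π) : sin y ≤ 0.8095 := by
  have hsqrt : √5 ≤ 2.238 := sqrt_le_iff.2 ⟨by norm_num, by norm_num⟩
  calc sin y = sin (π - y) := (sin_pi_sub y).symm
    _ ≤ sin (π / 2 - π / 5) :=
        sin_le_sin_of_le_of_le_pi_div_two (by linarith [pi_pos]) (by linarith [pi_pos])
          (by linarith)
    _ = (1 + √5) / 4 := by rw [sin_pi_div_two_sub, cos_pi_div_five]
    _ ≤ 0.8095 := by linarith

theorem two_mul_sin_div_add_le {q x : ℝ} (hx : 0 < x) (hx' : x ≤ 0.08) (hlo : 0.7 * π ≤ q * x)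
    (hhi : q * x ≤ π) : 2 * (sin (q * x) / sin x) + 1 / sin (2 * x) ≤ q := by
  have hpi := pi_gt_d2
  have hq : 0 < q := pos_of_mul_pos_left (by linarith) hx.le
  have hsin_q := sin_le_of_le_of_le_pi hlo hhi
  have hsin : 0.99 * x ≤ sin x := by
    have hcube := sin_gt_sub_cube hx
    have : x ^ 2 ≤ 0.06 := by nlinarith
    nlinarith
  have hcos : 0.99 ≤ cos x := by
    have := one_sub_sq_div_two_le_cos (x := x)
    nlinarith
  have hsin_pos : 0 < sin x := by linarith
  have hcos_inv : 1 / (2 * cos x) ≤ 0.51 := by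
    rw [div_le_iff₀ (by linarith)]
    linarith
  have hcombine : 2 * (sin (q * x) / sin x) + 1 / sin (2 * x) =
      (2 * sin (q * x) + 1 / (2 * cos x)) / sin x := by
    have : cos x ≠ 0 := by linarith
    rw [sin_two_mul]
    field_simp
  rw [hcombine, div_le_iff₀ hsin_pos]
  nlinarith [mul_le_mul_of_nonneg_left hsin hq.le]

theorem lapEigenvalue_le_two_mul_one {n k m : ℕ} (hn : 40 ≤ n) (h : Admissible n k)
    (hd : 0.7 * n ≤ (2 * k + 1 : ℝ)) (hm : 1 ≤ m) (hmn : m < n) :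
    lapEigenvalue n k m ≤ 2 * lapEigenvalue n k 1 := by
  wlog hm₂ : 2 * m ≤ n generalizing m
  · have := this (m := n - m) (by omega) (by omega) (by omega)
    rwa [Nat.cast_sub hmn.le, lapEigenvalue_natCast_sub (by omega)] at this
  obtain rfl | hm₁ := hm.eq_or_lt'
  · have := lapEigenvalue_pos (m := 1) h.1 le_rfl hmn
    rw [Nat.cast_one] at *
    linarith
  have hn' : (40 : ℝ) ≤ n := by exact_mod_cast hn
  have hx : π / n ≤ 0.08 := by
    rw [div_le_iff₀ (by linarith)]
    linarith [pi_lt_d2]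
  have hhi : (2 * k + 1) * (π / n) ≤ 1 * π :=
    mul_pi_div_le (by omega) (by rw [one_mul]; exact_mod_cast h.2)
  have htrig := two_mul_sin_div_add_le (q := 2 * k + 1) (by positivity) hx
    (le_mul_pi_div (by omega) hd) (hhi.trans_eq (one_mul π))
  have htail := neg_le_of_abs_le (abs_sin_div_sin_le one_le_two hm₁ hm₂
    ((2 * k + 1) * (m * (π / n))))
  rw [Nat.cast_two] at htail
  rw [lapEigenvalue_natCast k hm hmn, lapEigenvalue_one k (by omega)]
  linarith

/-! ### The ordered eigenvalues of the Laplacian -/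

section OrderedEigenvalues

variable {n : ℕ} {M : Matrix (Fin n) (Fin n) ℝ} (hM : M.IsHermitian)
include hM

theorem exists_orthonormal_eigenvectors :
    ∃ b : Fin (Fintype.card (Fin n)) → Fin n → ℝ,
      (∀ i, M.mulVec (b i) = hM.eigenvalues₀ i • b i) ∧
      ∀ i j, b i ⬝ᵥ b j = if i = j then 1 else 0 := by
  let e : Fin (Fintype.card (Fin n)) ≃ Fin n := Fintype.equivOfCardEq (Fintype.card_fin _)
  refine ⟨fun i => (hM.eigenvectorBasis (e i)).ofLp, fun i => ?_, fun i j => ?_⟩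
  · simpa [Matrix.IsHermitian.eigenvalues, e] using hM.mulVec_eigenvectorBasis (e i)
  · have hinner := orthonormal_iff_ite.1 hM.eigenvectorBasis.orthonormal (e j) (e i)
    rw [EuclideanSpace.inner_eq_star_dotProduct] at hinner
    simpa [eq_comm] using hinner

theorem exists_eigenvalues₀_eq {v : Fin n → ℝ} (hv : v ≠ 0) {c : ℝ} (hc : M.mulVec v = c • v) :
    ∃ i, hM.eigenvalues₀ i = c := by
  have heigen : Module.End.HasEigenvalue (Matrix.toLin' M) c :=
    Module.End.hasEigenvalue_of_hasEigenvector
      (Module.End.hasEigenvector_iff.2 ⟨Module.End.mem_eigenspace_iff.2 (by simpa using hc), hv⟩)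
  have hspec : c ∈ spectrum ℝ M := by
    rw [← Matrix.spectrum_toLin']
    exact heigen.mem_spectrum
  rw [hM.spectrum_real_eq_range_eigenvalues] at hspec
  obtain ⟨i, hi⟩ := hspec
  exact ⟨_, hi⟩

theorem exists_mulVec_eq_eigenvalues₀_smul (i : Fin (Fintype.card (Fin n))) :
    ∃ v ≠ 0, M.mulVec v = hM.eigenvalues₀ i • v := by
  obtain ⟨b, hb, hortho⟩ := exists_orthonormal_eigenvectors hM
  refine ⟨b i, fun hzero => ?_, hb i⟩
  simpa [hzero] using hortho i i

theorem eigenvalues₀_le_eig_self (i : Fin (Fintype.card (Fin n))) :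
    hM.eigenvalues₀ i ≤ eig hM n := by
  have hi : (i : ℕ) < n := i.2.trans_eq (Fintype.card_fin n)
  rw [eig, dif_pos ⟨by omega, le_rfl⟩]
  exact hM.eigenvalues₀_antitone (by simp [Fin.le_def])

theorem eig_two_le_of_eigenvalues₀_lt {i j : Fin (Fintype.card (Fin n))}
    (hij : hM.eigenvalues₀ j < hM.eigenvalues₀ i) : eig hM 2 ≤ hM.eigenvalues₀ i := by
  have hlt : i < j := hM.eigenvalues₀_antitone.reflect_lt hij
  have hj : (j : ℕ) < n := j.2.trans_eq (Fintype.card_fin n)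
  rw [Fin.lt_def] at hlt
  rw [eig, dif_pos ⟨by omega, by omega⟩]
  exact hM.eigenvalues₀_antitone (by rw [Fin.le_def]; dsimp only; omega)

/- Courant–Fischer: the span of the two bottom eigenvectors contains a nonzero vector of mean
zero. -/
theorem le_eig_two (hn : 2 ≤ n) {γ : ℝ}
    (hgap : ∀ u : Fin n → ℝ, ∑ i, u i = 0 → γ * (u ⬝ᵥ u) ≤ u ⬝ᵥ M.mulVec u) :
    γ ≤ eig hM 2 := by
  obtain ⟨b, hb, hortho⟩ := exists_orthonormal_eigenvectors hM
  rw [eig, dif_pos ⟨by omega, hn⟩]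
  set a : Fin (Fintype.card (Fin n)) := ⟨n - 2, by rw [Fintype.card_fin]; omega⟩ with ha
  set z : Fin (Fintype.card (Fin n)) := ⟨n - 1, by rw [Fintype.card_fin]; omega⟩ with hz
  have haz : a ≠ z := by simp only [ha, hz, ne_eq, Fin.mk.injEq]; omega
  have hanti : hM.eigenvalues₀ z ≤ hM.eigenvalues₀ a :=
    hM.eigenvalues₀_antitone (by simp only [ha, hz, Fin.mk_le_mk]; omega)
  have hquad : ∀ s t : ℝ, s * ∑ i, b a i + t * ∑ i, b z i = 0 →
      γ * (s ^ 2 + t ^ 2) ≤ hM.eigenvalues₀ a * s ^ 2 + hM.eigenvalues₀ z * t ^ 2 := by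
    intro s t hst
    have := hgap (s • b a + t • b z) (by
      simpa only [Pi.add_apply, Pi.smul_apply, smul_eq_mul, sum_add_distrib, ← mul_sum] using hst)
    simp only [Matrix.mulVec_add, Matrix.mulVec_smul, hb, dotProduct_add, add_dotProduct,
      dotProduct_smul, smul_dotProduct, hortho, haz, haz.symm, if_false, if_true,
      smul_eq_mul] at this
    linarith
  by_cases hsum : ∑ i, b a i = 0
  · simpa using hquad 1 0 (by rw [hsum]; ring)
  · have hpos : 0 < (∑ i, b z i) ^ 2 + (∑ i, b a i) ^ 2 := by positivity
    have := hquad (∑ i, b z i) (-∑ i, b a i) (by ring)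
    rw [neg_sq] at this
    refine le_of_mul_le_mul_right (this.trans ?_) hpos
    rw [mul_add]
    gcongr

end OrderedEigenvalues

theorem lap_mulVec (n k : ℕ) (u : Fin n → ℝ) :
    (lap n k).mulVec u = linearization (adj n k) 0 u := by
  classical
  funext i
  have hdegree : ((circulant n k).degree i : ℝ) * u i =
      ∑ j, (if (circulant n k).Adj i j then (1 : ℝ) else 0) * u i := by
    rw [← sum_mul, SimpleGraph.degree_eq_sum_if_adj]
  have hneighbors : ∑ j ∈ (circulant n k).neighborFinset i, u j =
      ∑ j, (if (circulant n k).Adj i j then (1 : ℝ) else 0) * u j := by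
    simp [SimpleGraph.neighborFinset_eq_filter, sum_filter]
  simp only [linearization, lap, SimpleGraph.lapMatrix_mulVec_apply, adj,
    SimpleGraph.adjMatrix_apply, Pi.zero_apply, sub_self, cos_zero, mul_one, mul_sub,
    sum_sub_distrib]
  rw [hdegree, hneighbors]

theorem lap_mulVec_eq_linearization_smul_twisted (n k : ℕ) (u : Fin n → ℝ) :
    (lap n k).mulVec u = linearization (adj n k) (((0 : ℕ) : ℝ) • twisted n) u := by
  rw [Nat.cast_zero, zero_smul, lap_mulVec]

section LapEigenvalues

variable {n k : ℕ}

theorem exists_eigenvalues₀_eq_lapEigenvalue (hkn : 2 * k < n) (m : ℕ) :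
    ∃ i, (lap_isHermitian n k).eigenvalues₀ i = lapEigenvalue n k m := by
  refine exists_eigenvalues₀_eq _ (cosMode_ne_zero (by omega) m) ?_
  rw [lap_mulVec_eq_linearization_smul_twisted, linearization_smul_twisted_cosMode hkn,
    Nat.cast_zero, modeEigenvalue_zero]

theorem exists_lapEigenvalue_eq (hkn : 2 * k < n) {v : Fin n → ℝ} (hv : v ≠ 0) {c : ℝ}
    (hc : (lap n k).mulVec v = c • v) : ∃ m < n, c = lapEigenvalue n k m := by
  by_contra! hne
  have hn : (n : ℝ) ≠ 0 := by exact_mod_cast (by omega : n ≠ 0)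
  rw [lap_mulVec_eq_linearization_smul_twisted] at hc
  have hmodes : ∀ m < n, cosMode n m ⬝ᵥ v = 0 ∧ sinMode n m ⬝ᵥ v = 0 := by
    intro m hm
    have hcos := cosMode_dotProduct_linearization hkn 0 m v
    have hsin := sinMode_dotProduct_linearization hkn 0 m v
    rw [hc, dotProduct_smul, smul_eq_mul, Nat.cast_zero, modeEigenvalue_zero] at hcos hsin
    exact ⟨(mul_eq_mul_right_iff.1 hcos).resolve_left (hne m hm),
      (mul_eq_mul_right_iff.1 hsin).resolve_left (hne m hm)⟩
  have hparseval := sum_modes_dotProduct_mul v v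
  rw [sum_eq_zero fun m hm => by
    rw [(hmodes m (mem_range.1 hm)).1, (hmodes m (mem_range.1 hm)).2, mul_zero, add_zero]]
    at hparseval
  exact hv (dotProduct_self_eq_zero.1 ((mul_eq_zero.1 hparseval.symm).resolve_left hn))

theorem lapEigenvalue_le_eig_self (hkn : 2 * k < n) (m : ℕ) :
    lapEigenvalue n k m ≤ eig (lap_isHermitian n k) n := by
  obtain ⟨i, hi⟩ := exists_eigenvalues₀_eq_lapEigenvalue hkn m
  exact hi ▸ eigenvalues₀_le_eig_self _ i

theorem exists_eig_self_eq_lapEigenvalue (h : Admissible n k) :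
    ∃ m, 1 ≤ m ∧ m < n ∧ eig (lap_isHermitian n k) n = lapEigenvalue n k m := by
  obtain ⟨hk, hkn⟩ := h
  have hpos : 0 < eig (lap_isHermitian n k) n :=
    (lapEigenvalue_pos hk le_rfl (by omega)).trans_le (lapEigenvalue_le_eig_self hkn 1)
  rw [eig, dif_pos ⟨by omega, le_rfl⟩] at hpos ⊢
  obtain ⟨v, hv, hvec⟩ := exists_mulVec_eq_eigenvalues₀_smul (lap_isHermitian n k) ⟨n - n, _⟩
  obtain ⟨m, hm, heig⟩ := exists_lapEigenvalue_eq hkn hv hvec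
  refine ⟨m, Nat.one_le_iff_ne_zero.2 ?_, hm, heig⟩
  rintro rfl
  rw [heig, Nat.cast_zero, lapEigenvalue_zero] at hpos
  exact lt_irrefl _ hpos

theorem eig_two_eq (h : Admissible n k) :
    eig (lap_isHermitian n k) 2 = lapEigenvalue n k 1 := by
  obtain ⟨hk, hkn⟩ := h
  refine le_antisymm ?_ (le_eig_two _ (by omega) ?_)
  · obtain ⟨i, hi⟩ := exists_eigenvalues₀_eq_lapEigenvalue hkn 1
    obtain ⟨j, hj⟩ := exists_eigenvalues₀_eq_lapEigenvalue hkn 0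
    have hpos := lapEigenvalue_pos hk (le_refl 1) (by omega : 1 < n)
    rw [Nat.cast_zero, lapEigenvalue_zero] at hj
    rw [← hj, ← hi] at hpos
    rw [← Nat.cast_one, ← hi]
    exact eig_two_le_of_eigenvalues₀_lt _ hpos
  · intro u hu
    rw [lap_mulVec_eq_linearization_smul_twisted]
    refine hasSpectralGap_smul_twisted hkn 0 (fun m hm hmn => ?_) u hu
    rw [Nat.cast_zero, modeEigenvalue_zero]
    exact lapEigenvalue_one_le hkn hm hmn

end LapEigenvalues

/-! ### Monotonicity and critical value of `kappa` -/

theorem kappa_denom_pos {μ : ℝ} (hμ : 0 < μ) : 0 < μ - sin (π * μ) / π := by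
  rw [sub_pos, div_lt_iff₀ pi_pos, mul_comm μ]
  exact sin_lt (by positivity)

theorem analyticAt_kappa {μ : ℝ} (hμ : 0 < μ) : AnalyticAt ℝ kappa μ := by
  have hnum : AnalyticAt ℝ (fun μ : ℝ => μ - sin (2 * π * μ) / (2 * π)) μ := by fun_prop
  have hden : AnalyticAt ℝ (fun μ : ℝ => μ - sin (π * μ) / π) μ := by fun_prop
  exact hnum.div hden (kappa_denom_pos hμ).ne'

theorem cos_two_pi_div_three : cos (2 * π / 3) = -(1 / 2) := by
  rw [show 2 * π / 3 = π - π / 3 by ring, cos_pi_sub, cos_pi_div_three]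

theorem sin_two_pi_div_three : sin (2 * π / 3) = √3 / 2 := by
  rw [show 2 * π / 3 = π - π / 3 by ring, sin_pi_sub, sin_pi_div_three]

section UpperDensity

variable {y : ℝ} (hlo : 0.6 * π ≤ y) (hhi : y < π)
include hlo hhi

theorem mul_one_add_two_mul_cos_lt : y * (1 + 2 * cos y) < sin y * (2 + cos y) := by
  have hpi := pi_lt_d2
  have hsin : 0 < sin y := sin_pos_of_pos_of_lt_pi (by linarith [pi_pos]) hhi
  rcases le_or_gt y (2 * π / 3) with hy | hy
  · have hcos_le : cos y ≤ -0.2 := by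
      have hjordan := mul_le_sin (x := y - π / 2) (by linarith [pi_pos]) (by linarith)
      rw [sin_sub_pi_div_two] at hjordan
      have : 0.2 = 2 / π * (0.1 * π) := by field_simp; norm_num
      have : 2 / π * (0.1 * π) ≤ 2 / π * (y - π / 2) := by gcongr; linarith
      linarith
    have hcos_ge : -(1 / 2) ≤ cos y := by
      rw [← cos_two_pi_div_three]
      exact cos_le_cos_of_nonneg_of_le_pi (by linarith [pi_pos]) (by linarith [pi_pos]) hy
    have hsin_ge : 0.865 ≤ sin y := by
      have hsqrt : 1.73 ≤ √3 := le_sqrt_of_sq_le (by norm_num)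
      have : √3 / 2 ≤ sin y := by
        rw [← sin_pi_div_three, ← sin_pi_sub y]
        exact sin_le_sin_of_le_of_le_pi_div_two (by linarith [pi_pos]) (by linarith) (by linarith)
      linarith
    calc y * (1 + 2 * cos y) ≤ 2.1 * 0.6 :=
          mul_le_mul (by linarith) (by linarith) (by linarith) (by norm_num)
      _ < 0.865 * 1.5 := by norm_num
      _ ≤ sin y * (2 + cos y) := mul_le_mul hsin_ge (by linarith) (by norm_num) hsin.le
  · have hcos_le : cos y ≤ -(1 / 2) := by
      rw [← cos_two_pi_div_three]
      exact cos_le_cos_of_nonneg_of_le_pi (by positivity) hhi.le hy.le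
    calc y * (1 + 2 * cos y) ≤ 0 :=
          mul_nonpos_of_nonneg_of_nonpos (by linarith [pi_pos]) (by linarith)
      _ < sin y * (2 + cos y) := mul_pos hsin (by linarith [neg_one_le_cos y])

theorem one_sub_cos_two_mul_mul_lt :
    (1 - cos (2 * y)) * (y - sin y) < (y - sin (2 * y) / 2) * (1 - cos y) := by
  have hcos : cos y < 1 := by
    rw [← cos_zero]
    exact cos_lt_cos_of_nonneg_of_le_pi le_rfl hhi.le (by linarith [pi_pos])
  have hprod := mul_pos (sub_pos.2 hcos) (sub_pos.2 (mul_one_add_two_mul_cos_lt hlo hhi))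
  rw [cos_two_mul, sin_two_mul]
  linear_combination hprod

end UpperDensity

theorem hasDerivAt_sub_sin_mul_div {c : ℝ} (hc : c ≠ 0) (x : ℝ) :
    HasDerivAt (fun x => x - sin (c * x) / c) (1 - cos (c * x)) x := by
  refine ((hasDerivAt_id x).sub
    (((hasDerivAt_id x).const_mul c).sin.div_const c)).congr_deriv ?_
  simp only [id_eq, mul_one, mul_div_cancel_right₀ _ hc]

theorem strictAntiOn_kappa : StrictAntiOn kappa (Set.Icc 0.6 1) := by
  refine strictAntiOn_of_deriv_neg (convex_Icc _ _)
    (fun μ hμ => (analyticAt_kappa (by linarith [hμ.1])).continuousAt.continuousWithinAt) ?_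
  intro μ hμ
  rw [interior_Icc] at hμ
  have hden := kappa_denom_pos (μ := μ) (by linarith [hμ.1])
  have hderiv : HasDerivAt kappa _ μ := (hasDerivAt_sub_sin_mul_div two_pi_pos.ne' μ).div
    (hasDerivAt_sub_sin_mul_div pi_ne_zero μ) hden.ne'
  rw [hderiv.deriv]
  refine div_neg_of_neg_of_pos (sub_neg.2 ?_) (by positivity)
  have htrig := one_sub_cos_two_mul_mul_lt (y := π * μ) (by nlinarith [hμ.1, pi_pos])
    (by nlinarith [hμ.2, pi_pos])
  rw [← mul_assoc] at htrig
  refine lt_of_mul_lt_mul_left ?_ pi_pos.le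
  calc π * ((1 - cos (2 * π * μ)) * (μ - sin (π * μ) / π))
      = (1 - cos (2 * π * μ)) * (π * μ - sin (π * μ)) := by field_simp
    _ < (π * μ - sin (2 * π * μ) / 2) * (1 - cos (π * μ)) := htrig
    _ = π * ((μ - sin (2 * π * μ) / (2 * π)) * (1 - cos (π * μ))) := by field_simp

theorem kappa_eq_div (μ : ℝ) :
    kappa μ = (π * μ - sin (π * μ) * cos (π * μ)) / (π * μ - sin (π * μ)) := by
  rw [kappa, ← mul_div_mul_left _ _ pi_ne_zero, mul_assoc 2 π μ, sin_two_mul]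
  congr 1 <;> field_simp

theorem two_lt_kappa_iff {μ : ℝ} (hμ : 0 < μ) :
    2 < kappa μ ↔ π * μ < sin (π * μ) * (2 - cos (π * μ)) := by
  rw [kappa_eq_div, lt_div_iff₀ (sub_pos.2 (sin_lt (by positivity)))]
  constructor <;> intro h <;> linarith

theorem kappa_lt_two_iff {μ : ℝ} (hμ : 0 < μ) :
    kappa μ < 2 ↔ sin (π * μ) * (2 - cos (π * μ)) < π * μ := by
  rw [kappa_eq_div, div_lt_iff₀ (sub_pos.2 (sin_lt (by positivity)))]
  constructor <;> intro h <;> linarith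

section NearTwoPiDivThree

variable {δ : ℝ} (hδ : 0 < δ)
include hδ

theorem le_sin_two_pi_div_three_add : √3 / 2 * (1 - δ ^ 2 / 2) - δ / 2 ≤ sin (2 * π / 3 + δ) := by
  have hcos := mul_le_mul_of_nonneg_left (one_sub_sq_div_two_le_cos (x := δ)) (sqrt_nonneg 3)
  rw [sin_add, sin_two_pi_div_three, cos_two_pi_div_three]
  linarith [sin_le hδ.le]

theorem sin_two_pi_div_three_add_le : sin (2 * π / 3 + δ) ≤ √3 / 2 - (δ - δ ^ 3 / 6) / 2 := by
  have hcos := mul_le_mul_of_nonneg_left (cos_le_one δ) (sqrt_nonneg 3)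
  rw [sin_add, sin_two_pi_div_three, cos_two_pi_div_three]
  linarith [sin_gt_sub_cube hδ]

theorem cos_two_pi_div_three_add_le (hδ' : δ ≤ π) :
    cos (2 * π / 3 + δ) ≤ -((1 - δ ^ 2 / 2) / 2) := by
  have hsin := mul_nonneg (sqrt_nonneg 3) (sin_nonneg_of_nonneg_of_le_pi hδ.le hδ')
  rw [cos_add, sin_two_pi_div_three, cos_two_pi_div_three]
  linarith [one_sub_sq_div_two_le_cos (x := δ)]

theorem le_cos_two_pi_div_three_add : -(1 / 2 + √3 / 2 * δ) ≤ cos (2 * π / 3 + δ) := by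
  have hsin := mul_le_mul_of_nonneg_left (sin_le hδ.le) (sqrt_nonneg 3)
  rw [cos_add, sin_two_pi_div_three, cos_two_pi_div_three]
  linarith [cos_le_one δ]

end NearTwoPiDivThree

theorem two_lt_kappa_lower : 2 < kappa 0.675 := by
  have hpi_lt := pi_lt_d4
  have hpi_gt := pi_gt_d4
  have hsqrt : 1.732 ≤ √3 := le_sqrt_of_sq_le (by norm_num)
  have hsin := le_sin_two_pi_div_three_add (δ := π / 120) (by positivity)
  have hcos := cos_two_pi_div_three_add_le (δ := π / 120) (by positivity) (by linarith)
  have hsq : (π / 120) ^ 2 / 2 ≤ 0.0004 := by nlinarith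
  rw [two_lt_kappa_iff (by norm_num), show π * 0.675 = 2 * π / 3 + π / 120 by ring]
  calc 2 * π / 3 + π / 120 < 0.8525 * 2.4998 := by linarith
    _ ≤ _ := mul_le_mul (by nlinarith) (by linarith) (by norm_num) (by nlinarith)

theorem kappa_upper_lt_two : kappa 0.685 < 2 := by
  have hpi_lt := pi_lt_d4
  have hpi_gt := pi_gt_d4
  have hsqrt : √3 ≤ 1.7321 := sqrt_le_iff.2 ⟨by norm_num, by norm_num⟩
  have hsin := sin_two_pi_div_three_add_le (δ := 11 * π / 600) (by positivity)
  have hcos := le_cos_two_pi_div_three_add (δ := 11 * π / 600) (by positivity)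
  have hcube : (11 * π / 600) ^ 3 ≤ 0.058 ^ 3 :=
    pow_le_pow_left₀ (by positivity) (by linarith) 3
  have hprod : √3 * (11 * π / 600) ≤ 1.7321 * 0.0577 := by gcongr; linarith
  rw [kappa_lt_two_iff (by norm_num), show π * 0.685 = 2 * π / 3 + 11 * π / 600 by ring]
  calc _ ≤ 0.8374 * 2.55 := mul_le_mul (by linarith) (by linarith)
        (by linarith [cos_le_one (2 * π / 3 + 11 * π / 600)]) (by norm_num)
    _ < 2 * π / 3 + 11 * π / 600 := by linarith

theorem exists_kappa_eq_two : ∃ μ : ℝ, |μ - 0.68| < 0.005 ∧ kappa μ = 2 := by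
  have hcont : ContinuousOn kappa (Set.Icc 0.675 0.685) := fun μ hμ =>
    (analyticAt_kappa (by linarith [hμ.1])).continuousAt.continuousWithinAt
  obtain ⟨μ, ⟨hlo, hhi⟩, hμ⟩ := intermediate_value_Ioo' (by norm_num) hcont
    ⟨kappa_upper_lt_two, two_lt_kappa_lower⟩
  exact ⟨μ, abs_lt.2 ⟨by linarith, by linarith⟩, hμ⟩

/-! ### The limit of the condition number -/

theorem abs_sin_natCast_mul_le (j : ℕ) (b : ℝ) : |sin (j * b)| ≤ j * |sin b| := by
  induction j with
  | zero => simp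
  | succ j ih =>
    rw [Nat.cast_succ, add_mul, one_mul, sin_add]
    refine (abs_add_le _ _).trans ?_
    rw [abs_mul, abs_mul]
    have hcos_b := mul_le_mul_of_nonneg_left (abs_cos_le_one b) (abs_nonneg (sin (j * b)))
    have hcos_jb := mul_le_mul_of_nonneg_right (abs_cos_le_one (j * b)) (abs_nonneg (sin b))
    linarith

section SmallAngle

variable {a : ℝ} (ha : a ≤ 0.4 * π)
include ha

theorem sin_pi_div_five_le_sin_two_mul (ha' : π / 4 ≤ a) : sin (π / 5) ≤ sin (2 * a) := by
  rw [← sin_pi_sub (2 * a)]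
  exact sin_le_sin_of_le_of_le_pi_div_two (by linarith [pi_pos]) (by linarith) (by linarith)

theorem neg_two_mul_sin_three_mul_le (ha₃ : π < 3 * a) : -(2 * sin (3 * a)) ≤ 3 * sin (2 * a) := by
  have hsin_two := sin_pi_div_five_le_sin_two_mul ha (by linarith)
  have hsin_three : sin (3 * a - π) ≤ sin (π / 5) :=
    sin_le_sin_of_le_of_le_pi_div_two (by linarith [pi_pos]) (by linarith [pi_pos]) (by linarith)
  rw [sin_sub_pi] at hsin_three
  linarith [lt_sin_pi_div_five]

theorem two_le_natCast_mul_sin_two_mul {m : ℕ} (hm : 5 ≤ m) (hma : π < m * a) :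
    2 ≤ m * sin (2 * a) := by
  have hm' : (5 : ℝ) ≤ m := by exact_mod_cast hm
  have ha₀ : 0 < a := pos_of_mul_pos_right (pi_pos.trans hma) (by linarith)
  rcases le_or_gt a (π / 4) with ha' | ha'
  · calc (2 : ℝ) ≤ 4 * (m * a) / π := by rw [le_div_iff₀ pi_pos]; linarith [pi_pos]
      _ = m * (2 / π * (2 * a)) := by ring
      _ ≤ m * sin (2 * a) := by
        gcongr
        exact mul_le_sin (by linarith) (by linarith)
  · nlinarith [sin_pi_div_five_le_sin_two_mul ha ha'.le, lt_sin_pi_div_five]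

theorem neg_one_pow_mul_two_mul_sin_le (ha₀ : 0 ≤ a) (m : ℕ) :
    (-1) ^ m * (2 * sin (m * a)) ≤ m * sin (2 * a) := by
  have hsin : 0 ≤ sin (2 * a) :=
    sin_nonneg_of_nonneg_of_le_pi (by linarith) (by linarith [pi_pos])
  rcases Nat.even_or_odd m with hm | hm
  · rw [hm.neg_one_pow, one_mul]
    obtain ⟨j, rfl⟩ := hm
    have hj := (le_abs_self _).trans (abs_sin_natCast_mul_le j (2 * a))
    rw [abs_of_nonneg hsin, ← mul_assoc, mul_two] at hj
    push_cast
    linarith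
  rw [hm.neg_one_pow, neg_one_mul]
  rcases le_or_gt (m * a) π with hma | hma
  · have := sin_nonneg_of_nonneg_of_le_pi (by positivity) hma
    exact (neg_nonpos.2 (by positivity)).trans (by positivity)
  obtain rfl | rfl | hm₅ : m = 1 ∨ m = 3 ∨ 5 ≤ m := by obtain ⟨j, rfl⟩ := hm; omega
  · rw [Nat.cast_one] at hma
    linarith [pi_pos]
  · exact_mod_cast neg_two_mul_sin_three_mul_le ha (by exact_mod_cast hma)
  · linarith [two_le_natCast_mul_sin_two_mul ha hm₅ hma, neg_one_le_sin (m * a)]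

end SmallAngle

theorem sinc_two_mul_le_sinc_natCast_mul {y : ℝ} (hlo : 0.6 * π ≤ y) (hhi : y ≤ π) {m : ℕ}
    (hm : 1 ≤ m) : sinc (2 * y) ≤ sinc (m * y) := by
  have hy : 0 < y := by linarith [pi_pos]
  have : (0 : ℝ) < m := by exact_mod_cast hm
  have hreflect := neg_one_pow_mul_two_mul_sin_le (a := π - y) (by linarith) (by linarith) m
  have hsin_two : sin (2 * y) = -sin (2 * (π - y)) := by rw [mul_sub, sin_two_pi_sub, neg_neg]
  have hsin : sin (m * y) = -((-1) ^ m * sin (m * (π - y))) := by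
    rw [← sin_nat_mul_pi_sub, mul_sub, sub_sub_cancel]
  rw [sinc_of_ne_zero (by positivity), sinc_of_ne_zero (by positivity),
    div_le_div_iff₀ (by positivity) (by positivity), hsin_two, hsin]
  linear_combination y * hreflect

theorem kappa_eq_sinc {μ : ℝ} (hμ : 0 < μ) :
    kappa μ = (1 - sinc (2 * (π * μ))) / (1 - sinc (π * μ)) := by
  rw [sinc_of_ne_zero (by positivity), sinc_of_ne_zero (by positivity), kappa,
    ← div_div_div_cancel_right₀ hμ.ne', mul_assoc 2 π μ]
  congr 1 <;> field_simp

theorem lapEigenvalue_natCast_div {n m : ℕ} (k : ℕ) (hm : 1 ≤ m) (hmn : m < n) :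
    lapEigenvalue n k m / (2 * k + 1) =
      1 - sinc (m * (π * ((2 * k + 1) / n))) / sinc (m * (π / n)) := by
  have hn : (0 : ℝ) < n := by exact_mod_cast (by omega : 0 < n)
  have : (0 : ℝ) < m := by exact_mod_cast hm
  have := (sin_natCast_mul_pi_div_pos hm hmn).ne'
  rw [lapEigenvalue_natCast k hm hmn, sinc_of_ne_zero (by positivity),
    sinc_of_ne_zero (by positivity),
    show (m : ℝ) * (π * ((2 * k + 1) / n)) = (2 * k + 1) * (m * (π / n)) by ring]
  field_simp

namespace HasDensity

variable {n k : ℕ → ℕ} {μ : ℝ} (h : HasDensity n k μ)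
include h

theorem tendsto_ratio : Tendsto (fun j => (2 * (k j : ℝ) + 1) / n j) atTop (𝓝 μ) := by
  obtain ⟨-, hn, -, hdensity⟩ := h
  simpa [add_div] using
    hdensity.add ((tendsto_one_div_atTop_nhds_zero_nat (𝕜 := ℝ)).comp hn)

theorem le_one : μ ≤ 1 := by
  refine le_of_tendsto h.tendsto_ratio (Eventually.of_forall fun j => ?_)
  exact div_le_one_of_le₀ (by exact_mod_cast (h.1 j).2) (by positivity)

theorem tendsto_lapEigenvalue {m : ℕ} (hm : 1 ≤ m) :
    Tendsto (fun j => lapEigenvalue (n j) (k j) m / (2 * k j + 1)) atTop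
      (𝓝 (1 - sinc (m * (π * μ)))) := by
  have hnum : Tendsto (fun j => sinc (m * (π * ((2 * (k j : ℝ) + 1) / n j)))) atTop
      (𝓝 (sinc (m * (π * μ)))) :=
    (continuous_sinc.tendsto _).comp ((h.tendsto_ratio.const_mul π).const_mul (m : ℝ))
  have hangle : Tendsto (fun j => (m : ℝ) * (π / n j)) atTop (𝓝 0) := by
    simpa using ((tendsto_const_div_atTop_nhds_zero_nat π).comp h.2.1).const_mul (m : ℝ)
  have hden := (continuous_sinc.tendsto 0).comp hangle
  have hlim := (hnum.div hden (by simp)).const_sub 1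
  rw [sinc_zero, div_one] at hlim
  refine hlim.congr' ?_
  filter_upwards [h.2.1.eventually (eventually_gt_atTop m)] with j hj
  exact (lapEigenvalue_natCast_div (k j) hm hj).symm

end HasDensity

theorem lapEigenvalue_natCast_le {n m : ℕ} (k : ℕ) (hm : 1 ≤ m) (hmn : 2 * m ≤ n) :
    lapEigenvalue n k m ≤ (2 * k + 1) + n / (2 * m) := by
  have hn : (0 : ℝ) < n := by exact_mod_cast (by omega : 0 < n)
  have : (0 : ℝ) < m := by exact_mod_cast hm
  have hsin : 2 * m / n ≤ sin (m * (π / n)) := by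
    refine le_of_eq_of_le ?_
      (mul_le_sin (by positivity) (natCast_mul_pi_div_le_half (by omega) hmn))
    field_simp
  have habs := neg_le_of_abs_le (abs_sin_div_sin_le hm le_rfl hmn ((2 * k + 1) * (m * (π / n))))
  have hinv : 1 / sin (m * (π / n)) ≤ n / (2 * m) :=
    (one_div_le_one_div_of_le (by positivity) hsin).trans_eq (one_div_div _ _)
  rw [lapEigenvalue_natCast k hm (by omega)]
  linarith

theorem exists_eig_self_eq_lapEigenvalue_le_half {n k : ℕ} (h : Admissible n k) :
    ∃ m, 1 ≤ m ∧ 2 * m ≤ n ∧ eig (lap_isHermitian n k) n = lapEigenvalue n k m := by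
  obtain ⟨m, hm, hmn, heig⟩ := exists_eig_self_eq_lapEigenvalue h
  rcases le_or_gt (2 * m) n with hm₂ | hm₂
  · exact ⟨m, hm, hm₂, heig⟩
  · refine ⟨n - m, by omega, by omega, ?_⟩
    rw [heig, Nat.cast_sub hmn.le, lapEigenvalue_natCast_sub (by omega)]

/- Once `2k + 1 ≥ n / 2`, all modes `m > M` satisfy `λ(m) ≤ (2k + 1)(1 + 1 / M)`, so only
finitely many modes compete with the limit. -/
theorem HasDensity.eventually_eig_self_div_lt {n k : ℕ → ℕ} {μ : ℝ} (h : HasDensity n k μ)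
    (hμ : 0.6 ≤ μ) {b ℓ : ℝ} (hℓ : 1 ≤ ℓ) (hb : ℓ < b)
    (hmode : ∀ m : ℕ, 1 ≤ m → 1 - sinc (m * (π * μ)) ≤ ℓ) :
    ∀ᶠ j in atTop, eig (lap_isHermitian (n j) (k j)) (n j) / (2 * k j + 1) < b := by
  obtain ⟨M, hM⟩ := exists_nat_one_div_lt (sub_pos.2 hb)
  have hlow : ∀ᶠ j in atTop, ∀ m ∈ Icc 1 M, lapEigenvalue (n j) (k j) m / (2 * k j + 1) < b := by
    rw [eventually_all_finset]
    intro m hm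
    rw [mem_Icc] at hm
    exact (h.tendsto_lapEigenvalue hm.1).eventually_lt_const ((hmode m hm.1).trans_lt hb)
  have hhalf : ∀ᶠ j in atTop, 1 / 2 < (2 * (k j : ℝ) + 1) / n j :=
    h.tendsto_ratio.eventually_const_lt (by linarith)
  filter_upwards [hlow, hhalf] with j hlow hhalf
  obtain ⟨m, hm, hmn, heig⟩ := exists_eig_self_eq_lapEigenvalue_le_half (h.1 j)
  rw [heig]
  rcases le_or_gt m M with hmM | hmM
  · exact hlow m (mem_Icc.2 ⟨hm, hmM⟩)
  have hn : (0 : ℝ) < n j := by exact_mod_cast (by omega : 0 < n j)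
  have hmM' : (M + 1 : ℝ) ≤ m := by exact_mod_cast hmM
  rw [lt_div_iff₀ hn] at hhalf
  have hk : (0 : ℝ) < 2 * k j + 1 := by positivity
  rw [div_lt_iff₀ hk]
  calc lapEigenvalue (n j) (k j) m ≤ (2 * k j + 1) + n j / (2 * m) :=
        lapEigenvalue_natCast_le (k j) hm hmn
    _ ≤ (2 * k j + 1) + 2 * (2 * k j + 1) / (2 * (M + 1)) := by gcongr; linarith
    _ = (1 + 1 / (M + 1)) * (2 * k j + 1) := by field_simp
    _ < b * (2 * k j + 1) := by gcongr; linarith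

theorem HasDensity.tendsto_eig_self {n k : ℕ → ℕ} {μ : ℝ} (h : HasDensity n k μ) (hμ : 0.6 ≤ μ) :
    Tendsto (fun j => eig (lap_isHermitian (n j) (k j)) (n j) / (2 * k j + 1)) atTop
      (𝓝 (1 - sinc (2 * (π * μ)))) := by
  have hlo : 0.6 * π ≤ π * μ := by nlinarith [pi_pos]
  have hhi : π * μ ≤ π := mul_le_of_le_one_right pi_pos.le h.le_one
  have hsin : sin (2 * (π * μ)) ≤ 0 := by
    rw [← sin_sub_two_pi]
    exact sin_nonpos_of_nonpos_of_neg_pi_le (by linarith) (by linarith [pi_pos])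
  have hsinc : sinc (2 * (π * μ)) ≤ 0 := by
    have : 0 < 2 * (π * μ) := by linarith [pi_pos]
    rw [sinc_of_ne_zero this.ne']
    exact div_nonpos_of_nonpos_of_nonneg hsin this.le
  refine tendsto_order.2 ⟨fun b hb => ?_, fun b hb => ?_⟩
  · have htwo := h.tendsto_lapEigenvalue one_le_two
    rw [Nat.cast_two] at htwo
    filter_upwards [htwo.eventually_const_lt hb] with j hj
    refine hj.trans_le ?_
    gcongr
    exact_mod_cast lapEigenvalue_le_eig_self (h.1 j).2 2
  · exact h.eventually_eig_self_div_lt hμ (by linarith) hb fun m hm =>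
      sub_le_sub_left (sinc_two_mul_le_sinc_natCast_mul hlo hhi hm) 1

theorem HasDensity.tendsto_condNumber {n k : ℕ → ℕ} {μ : ℝ} (h : HasDensity n k μ)
    (hμ : 0.6 ≤ μ) : Tendsto (fun j => condNumber (n j) (k j)) atTop (𝓝 (kappa μ)) := by
  have hμ₀ : 0 < μ := by linarith
  have hbottom := h.tendsto_lapEigenvalue le_rfl
  rw [Nat.cast_one, one_mul] at hbottom
  have hsinc : sinc (π * μ) < 1 := by
    rw [sinc_of_ne_zero (by positivity), div_lt_one (by positivity)]
    exact sin_lt (by positivity)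
  rw [kappa_eq_sinc hμ₀]
  refine ((h.tendsto_eig_self hμ).div hbottom (sub_pos.2 hsinc).ne').congr fun j => ?_
  rw [Pi.div_apply, div_div_div_cancel_right₀ (by positivity), condNumber, eig_two_eq (h.1 j)]

/-! ### Stability of the twisted state -/

theorem modeEigenvalue_one_pos {n k m : ℕ} (hk : 1 ≤ k) (hkn : 2 * k + 3 ≤ n)
    (htwo : 2 * lapEigenvalue n k 1 < lapEigenvalue n k 2) (hm : 1 ≤ m) (hmn : m < n) :
    0 < modeEigenvalue n k 1 m := by
  have hn : 0 < n := by omega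
  obtain rfl | hlast | ⟨hm₂, hmn₂⟩ : m = 1 ∨ m + 1 = n ∨ (2 ≤ m ∧ m + 2 ≤ n) := by omega
  · rw [Nat.cast_one, modeEigenvalue_one_one]
    linarith
  · have hm' : (m : ℝ) = n - 1 := eq_sub_of_add_eq (by exact_mod_cast hlast)
    have hzero := lapEigenvalue_natCast_sub hn k 0
    have hneg_two := lapEigenvalue_natCast_sub hn k 2
    rw [modeEigenvalue_one, hm', sub_add_cancel, sub_sub, one_add_one_eq_two, hneg_two]
    rw [sub_zero, lapEigenvalue_zero] at hzero
    linarith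
  · have hsucc : lapEigenvalue n k 1 ≤ lapEigenvalue n k (m + 1 : ℕ) :=
      lapEigenvalue_one_le (by omega) (by omega) (by omega)
    have hpred : lapEigenvalue n k 1 ≤ lapEigenvalue n k (m - 1 : ℕ) :=
      lapEigenvalue_one_le (by omega) (by omega) (by omega)
    have hstrict : lapEigenvalue n k 1 < lapEigenvalue n k (m + 1 : ℕ) ∨
        lapEigenvalue n k 1 < lapEigenvalue n k (m - 1 : ℕ) := by
      rcases le_or_gt (m + 3) n with hmn₃ | hmn₃
      · exact .inl (lapEigenvalue_one_lt hk hkn (by omega) (by omega))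
      · exact .inr (lapEigenvalue_one_lt hk hkn (by omega) (by omega))
    rw [Nat.cast_add_one] at hsucc hstrict
    rw [Nat.cast_sub hm, Nat.cast_one] at hpred hstrict
    rw [modeEigenvalue_one]
    rcases hstrict with hstrict | hstrict <;> linarith

theorem isStableEquilibrium_twisted_of_modeEigenvalue_pos {n k : ℕ} (hkn : 2 * k + 1 < n)
    (hpos : ∀ m : ℕ, 1 ≤ m → m < n → 0 < modeEigenvalue n k 1 m) {K : ℝ} (hK : 0 < K) :
    IsStableEquilibrium K (adj n k) (twisted n) := by
  obtain ⟨m₀, hm₀, hmin⟩ := exists_min_image (Ico 1 n) (fun m : ℕ => modeEigenvalue n k 1 m)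
    ⟨1, by rw [mem_Ico]; omega⟩
  rw [mem_Ico] at hm₀
  have hγ : ∀ m : ℕ, 1 ≤ m → m < n → modeEigenvalue n k 1 m₀ ≤ modeEigenvalue n k (1 : ℕ) m := by
    rw [Nat.cast_one]
    exact fun m hm hmn => hmin m (mem_Ico.2 ⟨hm, hmn⟩)
  have hequilibrium := isEquilibrium_smul_twisted (k := k) (n := n) (by omega) K 1
  have hgap := hasSpectralGap_smul_twisted (by omega) 1 hγ
  rw [Nat.cast_one, one_smul] at hequilibrium hgap
  exact isStableEquilibrium_of_hasSpectralGap (adj_isSymm n k) hK hequilibrium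
    (hpos m₀ hm₀.1 hm₀.2) hgap

theorem isStableEquilibrium_twisted_of_two_mul_lt {n k : ℕ} (hn : 7 ≤ n) (hk : 1 ≤ k)
    (hd : (2 * k + 1 : ℝ) ≤ 0.7 * n) (htwo : 2 * lapEigenvalue n k 1 < lapEigenvalue n k 2)
    {K : ℝ} (hK : 0 < K) : IsStableEquilibrium K (adj n k) (twisted n) := by
  have hkn : 2 * k + 3 ≤ n := by
    have hn' : (7 : ℝ) ≤ n := by exact_mod_cast hn
    exact_mod_cast (by linarith : (2 * k + 3 : ℝ) ≤ n)
  exact isStableEquilibrium_twisted_of_modeEigenvalue_pos (by omega)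
    (fun m => modeEigenvalue_one_pos hk hkn htwo) hK

theorem isStableEquilibrium_twisted_of_le {n k : ℕ} (hn : 7 ≤ n) (hk : 1 ≤ k)
    (hd : (2 * k + 1 : ℝ) ≤ 0.6 * n) {K : ℝ} (hK : 0 < K) :
    IsStableEquilibrium K (adj n k) (twisted n) :=
  isStableEquilibrium_twisted_of_two_mul_lt hn hk (hd.trans (by gcongr; norm_num))
    (two_mul_lapEigenvalue_one_lt_of_le hk hd) hK

theorem lapEigenvalue_one_pos {n k : ℕ} (h : Admissible n k) : 0 < lapEigenvalue n k 1 := by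
  obtain ⟨hk, hkn⟩ := h
  exact_mod_cast lapEigenvalue_pos hk le_rfl (by omega : 1 < n)

theorem isStableEquilibrium_twisted_of_two_lt_condNumber {n k : ℕ} (hn : 40 ≤ n)
    (h : Admissible n k) (hcond : 2 < condNumber n k) {K : ℝ} (hK : 0 < K) :
    IsStableEquilibrium K (adj n k) (twisted n) := by
  obtain ⟨m, hm, hmn, heig⟩ := exists_eig_self_eq_lapEigenvalue h
  rw [condNumber, eig_two_eq h, heig, lt_div_iff₀ (lapEigenvalue_one_pos h)] at hcond
  rcases le_or_gt (2 * k + 1 : ℝ) (0.6 * n) with hlo | hlo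
  · exact isStableEquilibrium_twisted_of_le (by omega) h.1 hlo hK
  rcases le_or_gt (2 * k + 1 : ℝ) (0.7 * n) with hhi | hhi
  · exact isStableEquilibrium_twisted_of_two_mul_lt (by omega) h.1 hhi
      (hcond.trans_le (lapEigenvalue_le_two (by omega) hlo.le hhi hm hmn)) hK
  · exact absurd (lapEigenvalue_le_two_mul_one hn h hhi.le hm hmn) hcond.not_ge

theorem IsStableEquilibrium.modeEigenvalue_one_nonneg {n k : ℕ} (hkn : 2 * k < n) {K : ℝ}
    (hK : 0 < K) (hstable : IsStableEquilibrium K (adj n k) (twisted n)) (m : ℕ) :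
    0 ≤ modeEigenvalue n k 1 m := by
  have hform := hstable.dotProduct_linearization_nonneg (adj_isSymm n k) hK (cosMode n m)
  have hmode := cosMode_dotProduct_linearization hkn 1 m (cosMode n m)
  rw [Nat.cast_one, one_smul] at hmode
  rw [hmode] at hform
  have hnorm : 0 < cosMode n m ⬝ᵥ cosMode n m := by
    simpa only [star_trivial] using
      Matrix.dotProduct_self_star_pos_iff.2 (cosMode_ne_zero (by omega : 0 < n) m)
  exact nonneg_of_mul_nonneg_left hform hnorm

theorem not_isStableEquilibrium_twisted_of_condNumber_lt_two {n k : ℕ} (h : Admissible n k)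
    (hcond : condNumber n k < 2) {K : ℝ} (hK : 0 < K) :
    ¬ IsStableEquilibrium K (adj n k) (twisted n) := by
  intro hstable
  have hnonneg := hstable.modeEigenvalue_one_nonneg h.2 hK 1
  rw [Nat.cast_one, modeEigenvalue_one_one] at hnonneg
  have htop := lapEigenvalue_le_eig_self h.2 2
  rw [Nat.cast_two] at htop
  rw [condNumber, eig_two_eq h, div_lt_iff₀ (lapEigenvalue_one_pos h)] at hcond
  linarith

theorem not_isSynchronized_twisted {n : ℕ} (hn : 2 ≤ n) : ¬ IsSynchronized (twisted n) := by
  intro hsync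
  obtain ⟨a, ha⟩ := Angle.angle_eq_iff_two_pi_dvd_sub.1 (hsync ⟨1, by omega⟩ ⟨0, by omega⟩)
  have hn' : (n : ℝ) ≠ 0 := by exact_mod_cast (by omega : n ≠ 0)
  have hmul : (a : ℝ) * n = 1 := by
    simp only [twisted, Nat.cast_one, Nat.cast_zero, mul_zero, zero_div, sub_zero, mul_one] at ha
    field_simp at ha
    rw [mul_comm, ha]
  have := Int.eq_one_or_neg_one_of_mul_eq_one' (by exact_mod_cast hmul : a * (n : ℤ) = 1)
  omega

/-! ### The critical density -/

theorem isCriticalDensity_of_kappa_eq_two {μc : ℝ} (hμc : μc ∈ Set.Icc 0.6 1)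
    (hκ : kappa μc = 2) {K : ℝ} (hK : 0 < K) : IsCriticalDensity K μc := by
  intro n k μ hd
  refine ⟨fun hlt => ?_, fun hlt => ?_⟩
  · have hlarge := hd.2.1.eventually (eventually_ge_atTop 40)
    rcases lt_or_ge μ 0.6 with hμ | hμ
    · filter_upwards [hlarge, hd.tendsto_ratio.eventually_lt_const hμ] with j hj hratio
      have hn : (0 : ℝ) < n j := by exact_mod_cast (by omega : 0 < n j)
      rw [div_lt_iff₀ hn] at hratio
      exact isStableEquilibrium_twisted_of_le (by omega) (hd.1 j).1 hratio.le hK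
    · have hκμ := strictAntiOn_kappa ⟨hμ, hd.le_one⟩ hμc hlt
      rw [hκ] at hκμ
      filter_upwards [hlarge, (hd.tendsto_condNumber hμ).eventually_const_lt hκμ] with j hj hcond
      exact isStableEquilibrium_twisted_of_two_lt_condNumber hj (hd.1 j) hcond hK
  · have hμ : 0.6 ≤ μ := hμc.1.trans hlt.le
    have hκμ := strictAntiOn_kappa hμc ⟨hμ, hd.le_one⟩ hlt
    rw [hκ] at hκμ
    filter_upwards [(hd.tendsto_condNumber hμ).eventually_lt_const hκμ] with j hcond
    exact not_isStableEquilibrium_twisted_of_condNumber_lt_two (hd.1 j) hcond hK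

theorem exists_hasDensity {μ : ℝ} (hμ : 0 < μ) (hμ' : μ < 1) : ∃ n k, HasDensity n k μ := by
  obtain ⟨N, hN⟩ := exists_nat_ge (max (2 / μ) (1 / (1 - μ)))
  rw [max_le_iff, div_le_iff₀ hμ, div_le_iff₀ (sub_pos.2 hμ')] at hN
  have hcast : Tendsto (fun j : ℕ => ((j + N : ℕ) : ℝ)) atTop atTop :=
    tendsto_natCast_atTop_atTop.comp (tendsto_add_atTop_nat N)
  refine ⟨fun j => j + N, fun j => ⌊μ / 2 * (j + N : ℕ)⌋₊, fun j => ⟨?_, ?_⟩,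
    tendsto_add_atTop_nat N, tendsto_nat_floor_atTop.comp (hcast.const_mul_atTop (by linarith)), ?_⟩
  · rw [Nat.one_le_floor_iff]
    push_cast
    nlinarith [(Nat.cast_nonneg j : (0 : ℝ) ≤ j)]
  · have hfloor := Nat.floor_le (a := μ / 2 * (j + N : ℕ)) (by positivity)
    have : (2 * ⌊μ / 2 * (j + N : ℕ)⌋₊ + 1 : ℝ) ≤ (j + N : ℕ) := by
      push_cast at hfloor ⊢
      nlinarith [(Nat.cast_nonneg j : (0 : ℝ) ≤ j)]
    exact_mod_cast this
  · have hlim := ((tendsto_nat_floor_mul_div_atTop (R := ℝ) (a := μ / 2) (by linarith)).comp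
      hcast).const_mul 2
    rw [mul_div_cancel₀ _ (two_ne_zero' ℝ)] at hlim
    exact hlim.congr fun j => (mul_div_assoc _ _ _).symm

theorem exists_condNumber_mem_Ioo {ε : ℝ} (hε : 0 < ε) :
    ∃ n k : ℕ, 40 ≤ n ∧ Admissible n k ∧ condNumber n k ∈ Set.Ioo 2 (2 + ε) := by
  obtain ⟨μc, hμc, hκ⟩ := exists_kappa_eq_two
  rw [abs_lt] at hμc
  have hcont : Tendsto kappa (𝓝[<] μc) (𝓝 2) := by
    have := (analyticAt_kappa (μ := μc) (by linarith)).continuousAt.tendsto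
    rw [hκ] at this
    exact this.mono_left nhdsWithin_le_nhds
  have hnear : ∀ᶠ μ in 𝓝[<] μc, (0.6 : ℝ) < μ :=
    mem_nhdsWithin_of_mem_nhds (Ioi_mem_nhds (by linarith))
  obtain ⟨μ, hμε, hμ, hlt⟩ := ((hcont.eventually_lt_const (by linarith : 2 < 2 + ε)).and
    (hnear.and self_mem_nhdsWithin)).exists
  have hgt := strictAntiOn_kappa ⟨hμ.le, by linarith⟩ ⟨by linarith, by linarith⟩ hlt
  rw [hκ] at hgt
  obtain ⟨n, k, hd⟩ := exists_hasDensity (μ := μ) (by linarith) (by linarith)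
  obtain ⟨j, hmem, hj⟩ := (((hd.tendsto_condNumber hμ.le).eventually_mem
    (Ioo_mem_nhds hgt hμε)).and (hd.2.1.eventually (eventually_ge_atTop 40))).exists
  exact ⟨n j, k j, hj, hd.1 j, hmem⟩

end Kuramoto

theorem theorem3p5 :
    -- for large `n`, a condition number `> 2` makes the twisted state a spurious stable equilibrium
    (∃ N : ℕ, ∀ n k : ℕ, N ≤ n → Kuramoto.Admissible n k → 2 < Kuramoto.condNumber n k →
      ¬ Kuramoto.IsSynchronized (Kuramoto.twisted n) ∧
      ∀ K : ℝ, 0 < K →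
        Kuramoto.IsStableEquilibrium K (Kuramoto.adj n k) (Kuramoto.twisted n)) ∧
    -- the limit of the condition number at density `μ ≥ 0.6`
    ((∀ (n k : ℕ → ℕ) (μ : ℝ), Kuramoto.HasDensity n k μ → 0.6 ≤ μ →
        Filter.Tendsto (fun j => Kuramoto.condNumber (n j) (k j)) Filter.atTop
          (nhds (Kuramoto.kappa μ))) ∧
      AnalyticOnNhd ℝ Kuramoto.kappa (Set.Icc 0.6 1) ∧
      StrictAntiOn Kuramoto.kappa (Set.Icc 0.6 1) ∧
      ∃ μc : ℝ, |μc - 0.68| < 0.005 ∧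
        (∀ K : ℝ, 0 < K → Kuramoto.IsCriticalDensity K μc) ∧
        Kuramoto.kappa μc = 2) ∧
    -- condition numbers arbitrarily close to `2` do not exclude spurious stable equilibria
    (∀ ε : ℝ, 0 < ε → ∃ n k : ℕ, Kuramoto.Admissible n k ∧
      Kuramoto.condNumber n k ≤ 2 + ε ∧
      ¬ Kuramoto.IsSynchronized (Kuramoto.twisted n) ∧
      ∀ K : ℝ, 0 < K →
        Kuramoto.IsStableEquilibrium K (Kuramoto.adj n k) (Kuramoto.twisted n)) := by
  refine ⟨⟨40, fun n k hn h hcond => ⟨Kuramoto.not_isSynchronized_twisted (by omega), fun K hK =>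
      Kuramoto.isStableEquilibrium_twisted_of_two_lt_condNumber hn h hcond hK⟩⟩,
    ⟨fun n k μ hd hμ => hd.tendsto_condNumber hμ,
      fun μ hμ => Kuramoto.analyticAt_kappa (by linarith [hμ.1]),
      Kuramoto.strictAntiOn_kappa, ?_⟩, fun ε hε => ?_⟩
  · obtain ⟨μc, hμc, hκ⟩ := Kuramoto.exists_kappa_eq_two
    have hmem : μc ∈ Set.Icc 0.6 1 := by constructor <;> linarith [abs_lt.1 hμc]
    exact ⟨μc, hμc, fun K hK => Kuramoto.isCriticalDensity_of_kappa_eq_two hmem hκ hK, hκ⟩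
  · obtain ⟨n, k, hn, h, hgt, hlt⟩ := Kuramoto.exists_condNumber_mem_Ioo hε
    exact ⟨n, k, h, hlt.le, Kuramoto.not_isSynchronized_twisted (by omega), fun K hK =>
      Kuramoto.isStableEquilibrium_twisted_of_two_lt_condNumber hn h hgt hK⟩
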